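/- All manifolds are smooth ($C^\infty$) and finite-dimensional. Let $(M,\omega)$ be a symplectic manifold of dimension $d$, let $H:M\to\mathbb R$ be smooth with Hamiltonian vector field $X_H$, $\mathrm i_{X_H}\omega=\mathrm dH$, and let $\Pi:M\to N$ be a fibration (a surjective submersion) onto a manifold $N$ of dimension $k$. For a subspace $W\subseteq T_xM$ let $W^{\perp}$ be its $\omega$-orthogonal. Let $m\in M$ be a point such that $X_H(m)\notin\operatorname{Ker}\Pi_{*,m}$ and $\operatorname{Ker}\Pi_{*,m}$ is co-isotropic, i.e. $(\operatorname{Ker}\Pi_{*,m})^{\perp}\subseteq\operatorname{Ker}\Pi_{*,m}$. If $U\subseteq M$ is open and $\Lambda$ is a manifold of dimension $d-k$, a local complete solution of the $\Pi$-Hamilton–Jacobi equation ($\Pi$-HJE) for $X_H$ along $U$ is a surjective local diffeomorphism $\Sigma:\Pi(U)\times\Lambda\to U$ such that $$\Pi\circ\Sigma=p_1\qquad\text{and}\qquad \mathrm i_{X_H^\Sigma}\Sigma^*\omega=\Sigma^*\mathrm dH,\qquad X_H^\Sigma(n,\lambda)=\bigl(\Pi_*(X_H(\Sigma(n,\lambda))),0\bigr),$$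 where $p_1:\Pi(U)\times\Lambda\to\Pi(U)$ is the first projection; $\Sigma$ is isotropic if $\sigma_\lambda^*\omega=0$ for every $\lambda\in\Lambda$, where $\sigma_\lambda=\Sigma(\cdot,\lambda):\Pi(U)\to U$. Theorem. There are an open neighbourhood $U$ of $m$ and, with $l=d-k$, a smooth submersion $F:U\to\mathbb R^{l}$ such that on $U$ $$X_H(x)\in\operatorname{Ker}F_{*,x},\qquad T_xM=\operatorname{Ker}\Pi_{*,x}\oplus\operatorname{Ker}F_{*,x},\qquad \operatorname{Ker}F_{*,x}\subseteq(\operatorname{Ker}F_{*,x})^{\perp}\qquad(x\in U),$$ such that $(\Pi|_U,F):U\to\Pi(U)\times F(U)$ is a bijection and its inverse $$\Sigma=(\Pi|_U,F)^{-1}:\Pi(U)\times F(U)\to U$$ is a local isotropic complete solution of the $\Pi$-HJE for $X_H$ along $U$ (with $\Lambda=F(U)$, an open subset of $\mathbb R^{l}$). -/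

import Mathlib

open Set
open scoped Manifold ContDiff Topology

noncomputable section

/-! ### Differential 2-forms and symplectic forms on manifolds -/

section Forms

variable {E : Type*} [NormedAddCommGroup E] [NormedSpace ℝ E]
  {E' : Type*} [NormedAddCommGroup E'] [NormedSpace ℝ E']
  {B : Type*} [TopologicalSpace B] {B' : Type*} [TopologicalSpace B']
  {M : Type*} [TopologicalSpace M] [ChartedSpace B M]
  {M' : Type*} [TopologicalSpace M'] [ChartedSpace B' M']

/-- A (not necessarily smooth) differential 2-form on `M`: an alternating bilinear form on every
tangent space. -/
abbrev TwoForm (I : ModelWithCorners ℝ E B) (M : Type*) [TopologicalSpace M] [ChartedSpace B M] :=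
  ∀ x : M, TangentSpace I x [⋀^Fin 2]→L[ℝ] ℝ

/-- The pull-back `f^* Ω`, i.e. `(f^* Ω)_x (v, w) = Ω_{f x} (f_* v, f_* w)`. -/
def TwoForm.pullback {I : ModelWithCorners ℝ E B} (I' : ModelWithCorners ℝ E' B')
    (f : M' → M) (Ω : TwoForm I M) : TwoForm I' M' :=
  fun x => (Ω (f x)).compContinuousLinearMap (mfderiv I' I f x)

/-- The symplectic orthogonal `K^⊥ = {v | Ω(v, w) = 0 for all w ∈ K}` of a subspace `K ⊆ T_x M`. -/
def TwoForm.orth {I : ModelWithCorners ℝ E B} (Ω : TwoForm I M) (x : M)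
    (K : Submodule ℝ (TangentSpace I x)) : Submodule ℝ (TangentSpace I x) where
  carrier := {v | ∀ w ∈ K, Ω x ![v, w] = 0}
  zero_mem' := by
    intro w _
    exact (Ω x).map_coord_zero (m := ![0, w]) 0 rfl
  add_mem' := by
    intro a b ha hb w hw
    have h := (Ω x).cons_add ![w] a b
    have ha' : Ω x (Fin.cons a ![w]) = 0 := ha w hw
    have hb' : Ω x (Fin.cons b ![w]) = 0 := hb w hw
    rw [ha', hb', add_zero] at h
    exact h
  smul_mem' := by
    intro c a ha w hw
    have h := (Ω x).cons_smul ![w] c a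
    have ha' : Ω x (Fin.cons a ![w]) = 0 := ha w hw
    rw [ha', smul_zero] at h
    exact h

end Forms

section Symplectic

variable {d : ℕ} {M : Type*} [TopologicalSpace M] [ChartedSpace (EuclideanSpace ℝ (Fin d)) M]

/-- The coordinate expression of a 2-form in the chart around `x₀`: its pull-back by the inverse of
that chart, a 2-form on (the chart target in) `ℝ^d`. -/
def TwoForm.inChart (Ω : TwoForm (𝓡 d) M) (x₀ : M) :
    EuclideanSpace ℝ (Fin d) → EuclideanSpace ℝ (Fin d) [⋀^Fin 2]→L[ℝ] ℝ :=
  fun y => Ω.pullback 𝓘(ℝ, EuclideanSpace ℝ (Fin d)) (extChartAt (𝓡 d) x₀).symm y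

/-- `Ω` is a symplectic form: smooth, closed and non-degenerate. Smoothness and closedness are
local and chart independent, and are checked in charts that cover the manifold. -/
structure TwoForm.IsSymplectic (Ω : TwoForm (𝓡 d) M) : Prop where
  smooth : ∀ x₀ : M, ContDiffOn ℝ ∞ (Ω.inChart x₀) (extChartAt (𝓡 d) x₀).target
  closed : ∀ x₀ : M, ∀ y ∈ (extChartAt (𝓡 d) x₀).target, extDeriv (Ω.inChart x₀) y = 0
  nondegenerate : ∀ (x : M) (v : TangentSpace (𝓡 d) x),
    (∀ w : TangentSpace (𝓡 d) x, Ω x ![v, w] = 0) → v = 0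

/-- `X` is the Hamiltonian vector field of `H` with respect to `Ω`, with the convention
`i_X Ω = dH`. -/
def IsHamiltonianVectorField (Ω : TwoForm (𝓡 d) M) (H : M → ℝ)
    (X : ∀ x : M, TangentSpace (𝓡 d) x) : Prop :=
  ∀ (x : M) (v : TangentSpace (𝓡 d) x), Ω x ![X x, v] = mfderiv (𝓡 d) 𝓘(ℝ, ℝ) H x v

end Symplectic

/-! ### Fibrations, first integrals and complete solutions

Below `M`, `N` and `L` are manifolds with models `I`, `J` and `K`. -/

section HamiltonJacobi

variable {E : Type*} [NormedAddCommGroup E] [NormedSpace ℝ E]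
  {B : Type*} [TopologicalSpace B] (I : ModelWithCorners ℝ E B)
  {M : Type*} [TopologicalSpace M] [ChartedSpace B M]
  {E₁ : Type*} [NormedAddCommGroup E₁] [NormedSpace ℝ E₁]
  {B₁ : Type*} [TopologicalSpace B₁] (J : ModelWithCorners ℝ E₁ B₁)
  {N : Type*} [TopologicalSpace N] [ChartedSpace B₁ N]
  {E₂ : Type*} [NormedAddCommGroup E₂] [NormedSpace ℝ E₂]
  {B₂ : Type*} [TopologicalSpace B₂] (K : ModelWithCorners ℝ E₂ B₂)
  {L : Type*} [TopologicalSpace L] [ChartedSpace B₂ L]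

/-- The subspace `Ker f_{*,x} ⊆ T_x M` of a map `f : M → N`. -/
def kerDeriv (f : M → N) (x : M) : Submodule ℝ (TangentSpace I x) :=
  LinearMap.ker (mfderiv I J f x).toLinearMap

/-- `f` is a smooth submersion on the (open) set `U`. -/
structure IsSmoothSubmersionOn (f : M → N) (U : Set M) : Prop where
  smooth : ContMDiffOn I J ∞ f U
  surjective_deriv : ∀ x ∈ U, Function.Surjective (mfderiv I J f x)

/-- A fibration: a surjective smooth submersion. -/
structure IsFibration (f : M → N) : Prop where
  submersion : IsSmoothSubmersionOn I J f univ
  surjective : Function.Surjective f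

/-- `F` is a first integrals submersion on `U` for the vector field `X`:
`Im X|_U ⊆ Ker F_*`. -/
structure IsFirstIntegralsSubmersionOn (X : ∀ x : M, TangentSpace I x) (F : M → L)
    (U : Set M) : Prop where
  submersion : IsSmoothSubmersionOn I K F U
  mem_ker : ∀ x ∈ U, X x ∈ kerDeriv I K F x

/-- `F` is transverse to `P` on `U`: `TU = Ker (P|_U)_* ⊕ Ker F_*`. -/
def IsTransverseOn (P : M → N) (F : M → L) (U : Set M) : Prop :=
  ∀ x ∈ U, IsCompl (kerDeriv I J P x) (kerDeriv I K F x)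

/-- `F` is isotropic on `U`: `Ker F_* ⊆ (Ker F_*)^⊥`. -/
def IsIsotropicMapOn (Ω : TwoForm I M) (F : M → L) (U : Set M) : Prop :=
  ∀ x ∈ U, kerDeriv I K F x ≤ Ω.orth x (kerDeriv I K F x)

/-- The vector field `X^S (n, a) = (P_* (X (S (n, a))), 0)` on `N × L`. It is used only at points
where `P (S (n, a)) = n`, so that the first component is a tangent vector at `n`. -/
def liftedField (X : ∀ x : M, TangentSpace I x) (P : M → N) (S : N × L → M) (p : N × L) :
    TangentSpace (J.prod K) p :=
  ((mfderiv I J P (S p) (X (S p)) : E₁), (0 : E₂))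

/-- `S` restricts to a complete solution `P(U) × A → U` of the `P|_U`-Hamilton-Jacobi equation for
`X|_U`, where `X` is the Hamiltonian vector field of `H`, `U ⊆ M` is open and `A ⊆ L` is an open
submanifold: `S : P(U) × A → U` is a surjective local diffeomorphism with
`i_{X^S} S^* Ω = S^* dH` and `P ∘ S = p_N` (the values of `S` outside `P(U) × A` play no role).
For `U = M` and `A = L` this is a global complete solution. -/
structure IsCompleteSolutionAlong (Ω : TwoForm I M) (H : M → ℝ)
    (X : ∀ x : M, TangentSpace I x) (P : M → N) (U : Set M) (A : Set L) (S : N × L → M) :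
    Prop where
  isOpen_U : IsOpen U
  isOpen_A : IsOpen A
  localDiffeo : IsLocalDiffeomorphOn (J.prod K) I ∞ S ((P '' U) ×ˢ A)
  image_eq : S '' ((P '' U) ×ˢ A) = U
  section_eq : ∀ p ∈ (P '' U) ×ˢ A, P (S p) = p.1
  hamiltonJacobi : ∀ p ∈ (P '' U) ×ˢ A, ∀ v : TangentSpace (J.prod K) p,
    Ω.pullback (J.prod K) S p ![liftedField I J K X P S p, v] =
      mfderiv I 𝓘(ℝ, ℝ) H (S p) (mfderiv (J.prod K) I S p v)

/-- `S` is isotropic on `V × A`: every partial map `σ_a = S(·, a)`, `a ∈ A`, satisfies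
`σ_a^* Ω = 0` on `V`. -/
def IsIsotropicSolutionOn {I : ModelWithCorners ℝ E B} (Ω : TwoForm I M) (V : Set N) (A : Set L)
    (S : N × L → M) : Prop :=
  ∀ a ∈ A, ∀ n ∈ V, Ω.pullback J (fun n' : N => S (n', a)) n = 0

end HamiltonJacobi

end

/-! In a chart at `m`, the kernel of `Π_*` at `m` becomes a co-isotropic subspace `C` of dimension
`l = d - k`, and the Hamiltonian field of `h`, the local form of `H`, points out of it. What is
wanted is a foliation by isotropic leaves of dimension `k`, tangent to that field and transverse to
`C`. It is found by completing `h` to `k` functions in involution whose Hamiltonian fields at the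
base point span a complement `W` of `C` (`exists_isInvolutive`). As long as `W + C` is not
everything, some `c ≠ 0` is orthogonal to it; co-isotropy puts `c` in `C`, hence outside `W`, so
some `w` is orthogonal to `W` but not to `c`, and `w ∉ W + C` (`exists_notMem_sup`). The covector
`ω(w, ·)` kills the fields found so far. These fields commute, so the covector is the differential
at the point of a common first integral (`exists_common_firstIntegral`), and that function joins the
family.

Once there are `k` functions, the components of `F` are common first integrals of their fields, with
differentials at the point that cut out `W`. Nearby, `Ker F_*` is the span of the fields by
dimension, so it is isotropic and contains the field of `h`. The inverse function theorem makes `(Π,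
F)` a diffeomorphism onto a box, with inverse `Σ`. Since `F_* X_H = 0`, `Σ_*` sends `X_H^Σ` to
`X_H`, and the Hamilton–Jacobi equation is the pull-back of `i_{X_H} ω = dH`; the partial maps of
`Σ` are isotropic because they are tangent to the leaves.

Common first integrals come by induction on the number of commuting fields: points are moved along
one field to a level set of a first integral of the others. This needs flows smooth in the initial
point, which the implicit function theorem gives when applied to the integral equation in `C([0, 1],
E)` (`exists_flow_of_contDiff`). -/

noncomputable section

/-! ### Smooth implicit functions near a point -/

section Implicit

variable {E₁ : Type*} [NormedAddCommGroup E₁] [NormedSpace ℝ E₁] [CompleteSpace E₁]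
  {E₂ : Type*} [NormedAddCommGroup E₂] [NormedSpace ℝ E₂] [CompleteSpace E₂]
  {F : Type*} [NormedAddCommGroup F] [NormedSpace ℝ F] [CompleteSpace F]

open Filter in
/-- The implicit function theorem for maps that are `C^∞` on a neighbourhood of a point: the
implicit function is `C^∞` on a neighbourhood, and the partial derivative stays invertible. -/
theorem exists_implicitFunction_eventually_contDiffAt {f : E₁ × E₂ → F} {u : E₁ × E₂}
    (hf : ∀ᶠ v in 𝓝 u, ContDiffAt ℝ ∞ f v)
    (hinv : (fderiv ℝ f u ∘L .inr ℝ E₁ E₂).IsInvertible) :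
    ∃ ψ : E₁ → E₂, ψ u.1 = u.2 ∧ ∀ᶠ x in 𝓝 u.1, f (x, ψ x) = f u ∧ ContDiffAt ℝ ∞ ψ x ∧
      ContDiffAt ℝ ∞ f (x, ψ x) ∧ (fderiv ℝ f (x, ψ x) ∘L .inr ℝ E₁ E₂).IsInvertible := by
  have hn : (∞ : WithTop ℕ∞) ≠ 0 := by simp
  have cdf := hf.self_of_nhds
  have hinv' : ∀ᶠ v in 𝓝 u, (fderiv ℝ f v ∘L .inr ℝ E₁ E₂).IsInvertible := by
    have hc : ContinuousAt (fun v => fderiv ℝ f v ∘L .inr ℝ E₁ E₂) u :=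
      ((cdf.fderiv_right (m := 0) (by simp)).continuousAt).clm_comp continuousAt_const
    obtain ⟨e, he⟩ := hinv
    have := ContinuousLinearEquiv.nhds e
    rw [he] at this
    filter_upwards [hc.eventually this] with v hv
    obtain ⟨e', he'⟩ := hv
    exact ⟨e', he'⟩
  set ψ := cdf.implicitFunction hn hinv
  have h0 : ψ u.1 = u.2 := cdf.implicitFunction_apply_self hn hinv
  have hψc : ContinuousAt (fun x => (x, ψ x)) u.1 :=
    continuousAt_id.prodMk (cdf.contDiffAt_implicitFunction hn hinv).continuousAt
  have hψt : Tendsto (fun x => (x, ψ x)) (𝓝 u.1) (𝓝 u) := by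
    have := hψc.tendsto
    rwa [h0] at this
  refine ⟨ψ, h0, ?_⟩
  filter_upwards [cdf.eventually_apply_implicitFunction hn hinv, hψt.eventually hf,
    hψt.eventually hinv', hψt.eventually
      (cdf.eventually_apply_eq_iff_implicitFunction hn hinv).eventually_nhds]
    with x hx hxf hxi hxe
  refine ⟨hx, ?_, hxf, hxi⟩
  -- `ContDiffAt ℝ ∞` at one point gives no common neighbourhood for all orders. Smoothness at `x`
  -- therefore comes from the implicit function based at `(x, ψ x)`, which agrees with `ψ` near `x`
  -- by local uniqueness.
  have hψ' := hxf.contDiffAt_implicitFunction hn hxi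
  refine hψ'.congr_of_eventuallyEq ?_
  have h0' : hxf.implicitFunction hn hxi x = ψ x := hxf.implicitFunction_apply_self hn hxi
  have ht : Tendsto (fun y => (y, hxf.implicitFunction hn hxi y)) (𝓝 x) (𝓝 (x, ψ x)) := by
    have := (continuousAt_id.prodMk hψ'.continuousAt).tendsto
    simp only [id, h0'] at this
    exact this
  filter_upwards [ht.eventually hxe, hxf.eventually_apply_implicitFunction hn hxi] with y h1 h2
  exact h1.1 (h2.trans hx)

end Implicit

/-! ### Composition operators on spaces of continuous functions -/

section Superposition

universe u

variable {K : Type*} [TopologicalSpace K] [CompactSpace K]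
  {E : Type u} [NormedAddCommGroup E] [NormedSpace ℝ E]
  {F : Type u} [NormedAddCommGroup F] [NormedSpace ℝ F]

/-- Pointwise application of a continuous family of operators to a continuous function, as a
continuous bilinear map. -/
def pointwiseApplyCLM (K : Type*) [TopologicalSpace K] [CompactSpace K]
    (E : Type u) [NormedAddCommGroup E] [NormedSpace ℝ E]
    (F : Type u) [NormedAddCommGroup F] [NormedSpace ℝ F] :
    C(K, E →L[ℝ] F) →L[ℝ] C(K, E) →L[ℝ] C(K, F) :=
  LinearMap.mkContinuous₂
    (LinearMap.mk₂ ℝ (fun (A : C(K, E →L[ℝ] F)) (h : C(K, E)) =>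
      (⟨fun t => A t (h t), A.continuous.clm_apply h.continuous⟩ : C(K, F)))
      (fun _ _ _ => by ext; simp) (fun _ _ _ => by ext; simp)
      (fun _ _ _ => by ext; simp) (fun _ _ _ => by ext; simp)) 1
    (fun A h => by
      rw [one_mul, ContinuousMap.norm_le _ (by positivity)]
      intro t
      exact ((A t).le_opNorm _).trans (mul_le_mul (A.norm_coe_le_norm t) (h.norm_coe_le_norm t)
        (norm_nonneg _) (norm_nonneg A)))

/-- If `V` is `C^1`, then `u ↦ V ∘ u` is differentiable, with derivative `h ↦ (V' ∘ u) h`. -/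
theorem hasFDerivAt_continuousMap_comp (V : C(E, F)) (V' : C(E, E →L[ℝ] F))
    (hV : ∀ x, HasFDerivAt V (V' x) x) (u : C(K, E)) :
    HasFDerivAt (fun u : C(K, E) => V.comp u) (pointwiseApplyCLM K E F (V'.comp u)) u := by
  rw [hasFDerivAt_iff_isLittleO_nhds_zero, Asymptotics.isLittleO_iff]
  intro c hc
  have hcomp : IsCompact (range u) := isCompact_range u.continuous
  -- Continuity of `V'` is uniform along the compact range of `u`, so one `δ` serves all `t` in the
  -- mean value inequality below.
  have hunif := hcomp.uniformContinuousAt_of_continuousAt V'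
    (fun x _ => V'.continuous.continuousAt) (Metric.dist_mem_uniformity hc)
  obtain ⟨δ, hδ, hδ'⟩ := Metric.mem_uniformity_dist.1 hunif
  filter_upwards [Metric.ball_mem_nhds (0 : C(K, E)) hδ] with h hh
  rw [ContinuousMap.norm_le _ (by positivity)]
  intro t
  have hht : ‖h t‖ ≤ ‖h‖ := h.norm_coe_le_norm t
  have hhδ : ‖h t‖ < δ := hht.trans_lt (by simpa using hh)
  have key := (convex_ball (u t) δ).norm_image_sub_le_of_norm_hasFDerivWithin_le' (f := V)
    (f' := V') (φ := V' (u t)) (C := c) (x := u t) (y := u t + h t)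
    (fun x _ => (hV x).hasFDerivWithinAt)
    (fun x hx => by
      have := hδ' (a := u t) (b := x) (by rw [dist_comm]; exact hx) (mem_range_self t)
      rw [← dist_eq_norm, dist_comm]
      exact le_of_lt this)
    (Metric.mem_ball_self hδ) (by simpa using hhδ)
  simp only [add_sub_cancel_left] at key
  exact key.trans (mul_le_mul_of_nonneg_left hht hc.le)

/-- If `V` is smooth, then so is `u ↦ V ∘ u`. -/
theorem contDiff_continuousMap_comp {V : C(E, F)} (hV : ContDiff ℝ ∞ V) :
    ContDiff ℝ ∞ (fun u : C(K, E) => V.comp u) := by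
  rw [contDiff_infty]
  intro n
  -- The derivative is composition with `fderiv ℝ V`, followed by a continuous linear map. Its
  -- target is `E →L[ℝ] F`, hence the induction over all `F` and the common universe.
  induction n generalizing F with
  | zero =>
    rw [Nat.cast_zero, contDiff_zero]
    exact ContinuousMap.continuous_postcomp V
  | succ n ih =>
    have hV' : ContDiff ℝ ∞ (fderiv ℝ V) := hV.fderiv_right (by simp)
    rw [Nat.cast_succ, contDiff_succ_iff_hasFDerivAt]
    refine ⟨fun u => pointwiseApplyCLM K E F
      ((⟨fderiv ℝ V, hV'.continuous⟩ : C(E, E →L[ℝ] F)).comp u), ?_, ?_⟩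
    · exact (pointwiseApplyCLM K E F).contDiff.comp
        (ih (V := (⟨fderiv ℝ V, hV'.continuous⟩ : C(E, E →L[ℝ] F))) hV')
    · exact hasFDerivAt_continuousMap_comp V ⟨fderiv ℝ V, hV'.continuous⟩
        (fun x => (hV.differentiable (by simp) x).hasFDerivAt)

end Superposition

/-! ### Integration as an operator on `C([0, 1], E)`. -/

section Primitive

variable {E : Type*} [NormedAddCommGroup E]

/-- A continuous function on `[0, 1]`, extended to `ℝ` by constants. -/
def extendIcc (u : C(Icc (0 : ℝ) 1, E)) : ℝ → E := IccExtend zero_le_one u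

theorem continuous_extendIcc (u : C(Icc (0 : ℝ) 1, E)) : Continuous (extendIcc u) :=
  u.continuous.Icc_extend'

theorem extendIcc_coe (u : C(Icc (0 : ℝ) 1, E)) (t : Icc (0 : ℝ) 1) : extendIcc u t = u t :=
  IccExtend_val zero_le_one u t

variable [NormedSpace ℝ E] [CompleteSpace E]

theorem hasDerivAt_integral_extendIcc (u : C(Icc (0 : ℝ) 1, E)) (t : ℝ) :
    HasDerivAt (fun t => ∫ s in (0 : ℝ)..t, extendIcc u s) (extendIcc u t) t :=
  intervalIntegral.integral_hasDerivAt_right ((continuous_extendIcc u).intervalIntegrable _ _)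
    ((continuous_extendIcc u).stronglyMeasurableAtFilter _ _)
    (continuous_extendIcc u).continuousAt

/-- The operator `u ↦ ∫₀ᵗ u` on `C([0, 1], E)`. -/
def primitiveCLM (E : Type*) [NormedAddCommGroup E] [NormedSpace ℝ E] [CompleteSpace E] :
    C(Icc (0 : ℝ) 1, E) →L[ℝ] C(Icc (0 : ℝ) 1, E) :=
  LinearMap.mkContinuous
    { toFun := fun u => ⟨fun t => ∫ s in (0 : ℝ)..t, extendIcc u s,
        (continuous_iff_continuousAt.2 fun t =>
          (hasDerivAt_integral_extendIcc u t).continuousAt).comp continuous_subtype_val⟩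
      map_add' := fun u v => by
        ext t
        exact intervalIntegral.integral_add ((continuous_extendIcc u).intervalIntegrable _ _)
          ((continuous_extendIcc v).intervalIntegrable _ _)
      map_smul' := fun c u => by
        ext t
        exact intervalIntegral.integral_smul c (extendIcc u) } 1
    (fun u => by
      rw [one_mul, ContinuousMap.norm_le _ (norm_nonneg _)]
      intro t
      have := intervalIntegral.norm_integral_le_of_norm_le_const (a := (0 : ℝ)) (b := t)
        (f := extendIcc u) (C := ‖u‖) (fun s _ => u.norm_coe_le_norm _)
      refine this.trans (mul_le_of_le_one_right (norm_nonneg _) ?_)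
      rw [sub_zero, abs_of_nonneg t.2.1]
      exact t.2.2)

theorem primitiveCLM_apply (u : C(Icc (0 : ℝ) 1, E)) (t : Icc (0 : ℝ) 1) :
    primitiveCLM E u t = ∫ s in (0 : ℝ)..t, extendIcc u s := rfl

end Primitive

/-! ### Smooth local flows -/

section Flow

variable {E : Type*} [NormedAddCommGroup E] [NormedSpace ℝ E]

/-- Constant functions, as a continuous linear map. -/
def constFunCLM (E : Type*) [NormedAddCommGroup E] [NormedSpace ℝ E] :
    E →L[ℝ] C(Icc (0 : ℝ) 1, E) :=
  LinearMap.mkContinuous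
    { toFun := fun x => ContinuousMap.const _ x
      map_add' := fun _ _ => rfl
      map_smul' := fun _ _ => rfl } 1
    (fun x => by
      rw [one_mul, ContinuousMap.norm_le _ (norm_nonneg _)]
      intro t
      exact le_rfl)

@[simp] theorem constFunCLM_apply (x : E) (t : Icc (0 : ℝ) 1) : constFunCLM E x t = x := rfl

/-- The derivative of `u ↦ V ∘ u`. -/
def linearizedComp (V : C(E, E)) (hV : ContDiff ℝ ∞ V) (u : C(Icc (0 : ℝ) 1, E)) :
    C(Icc (0 : ℝ) 1, E) →L[ℝ] C(Icc (0 : ℝ) 1, E) :=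
  pointwiseApplyCLM _ E E
    ((⟨fderiv ℝ V, hV.continuous_fderiv (by simp)⟩ : C(E, E →L[ℝ] E)).comp u)

@[simp] theorem linearizedComp_apply (V : C(E, E)) (hV : ContDiff ℝ ∞ V)
    (u h : C(Icc (0 : ℝ) 1, E)) (t : Icc (0 : ℝ) 1) :
    linearizedComp V hV u h t = fderiv ℝ V (u t) (h t) := rfl

variable [CompleteSpace E]

/-- The map whose zeros `((τ, x), u)` are the solutions of `u t = x + τ ∫₀ᵗ V (u s) ds`. -/
def flowEquation (V : C(E, E)) (p : (ℝ × E) × C(Icc (0 : ℝ) 1, E)) : C(Icc (0 : ℝ) 1, E) :=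
  p.2 - constFunCLM E p.1.2 - p.1.1 • primitiveCLM E (V.comp p.2)

theorem contDiff_flowEquation {V : C(E, E)} (hV : ContDiff ℝ ∞ V) :
    ContDiff ℝ ∞ (flowEquation V) := by
  have h1 : ContDiff ℝ ∞ (fun p : (ℝ × E) × C(Icc (0 : ℝ) 1, E) => V.comp p.2) :=
    (contDiff_continuousMap_comp hV).comp contDiff_snd
  unfold flowEquation
  fun_prop

theorem fderiv_flowEquation_apply {V : C(E, E)} (hV : ContDiff ℝ ∞ V)
    (p : (ℝ × E) × C(Icc (0 : ℝ) 1, E)) (a : (ℝ × E) × C(Icc (0 : ℝ) 1, E)) :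
    fderiv ℝ (flowEquation V) p a = a.2 - constFunCLM E a.1.2 -
      (p.1.1 • primitiveCLM E (linearizedComp V hV p.2 a.2) +
        a.1.1 • primitiveCLM E (V.comp p.2)) := by
  have hN : HasFDerivAt (fun u : C(Icc (0 : ℝ) 1, E) => V.comp u) (linearizedComp V hV p.2) p.2 :=
    hasFDerivAt_continuousMap_comp V ⟨fderiv ℝ V, hV.continuous_fderiv (by simp)⟩
      (fun x => (hV.differentiable (by simp) x).hasFDerivAt) p.2
  have h1 : HasFDerivAt (fun p : (ℝ × E) × C(Icc (0 : ℝ) 1, E) => primitiveCLM E (V.comp p.2))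
      ((primitiveCLM E) ∘L (linearizedComp V hV p.2) ∘L
        ContinuousLinearMap.snd ℝ (ℝ × E) C(Icc (0 : ℝ) 1, E)) p :=
    (primitiveCLM E).hasFDerivAt.comp p (hN.comp p hasFDerivAt_snd)
  have h2 := ((hasFDerivAt_snd (𝕜 := ℝ) (p := p)).sub
    ((constFunCLM E).hasFDerivAt.comp p
      ((hasFDerivAt_snd (𝕜 := ℝ) (p := p.1)).comp p hasFDerivAt_fst))).sub
    (((hasFDerivAt_fst (𝕜 := ℝ) (p := p.1)).comp p hasFDerivAt_fst).smul h1)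
  have h3 : HasFDerivAt (flowEquation V) _ p := h2
  rw [h3.fderiv]
  simp

/-- A solution of the integral equation satisfies `t V(u t) = ∫₀ᵗ (V(u) + τ V'(u) (s V(u s))) ds`,
so that `t ↦ t V(u t)` solves the equation linearized in the direction of `τ`. -/
theorem fderiv_flowEquation_smul {V : C(E, E)} (hV : ContDiff ℝ ∞ V) {τ : ℝ} {x : E}
    {u : C(Icc (0 : ℝ) 1, E)} (h : flowEquation V ((τ, x), u) = 0) (z : C(Icc (0 : ℝ) 1, E))
    (hz : ∀ t, z t = (t : ℝ) • V (u t)) :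
    fderiv ℝ (flowEquation V) ((τ, x), u) ((1, 0), z) = 0 := by
  rw [fderiv_flowEquation_apply hV]
  ext t
  simp only [map_zero, sub_zero, one_smul, ContinuousMap.sub_apply, ContinuousMap.add_apply,
    ContinuousMap.smul_apply, ContinuousMap.zero_apply, primitiveCLM_apply, hz]
  -- The function `u` lives on `[0, 1]` only; the integral equation extends it to `w`, which has a
  -- two-sided derivative everywhere.
  set w : ℝ → E := fun t => x + τ • ∫ s in (0 : ℝ)..t, extendIcc (V.comp u) s
  have hw : ∀ t, HasDerivAt w (τ • extendIcc (V.comp u) t) t := fun t =>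
    ((hasDerivAt_integral_extendIcc (V.comp u) t).const_smul τ).const_add x
  have hwu : ∀ t : Icc (0 : ℝ) 1, w t = u t := by
    intro t
    have := DFunLike.congr_fun h t
    simp only [flowEquation, ContinuousMap.sub_apply, constFunCLM_apply, ContinuousMap.smul_apply,
      primitiveCLM_apply, ContinuousMap.zero_apply] at this
    rw [sub_sub, sub_eq_zero] at this
    exact this.symm
  have hD : ∀ t ∈ Icc (0 : ℝ) 1, HasDerivAt (fun t => t • V (w t))
      (τ • extendIcc (linearizedComp V hV u z) t + extendIcc (V.comp u) t) t := by
    intro t ht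
    have h1 : HasDerivAt (fun t => V (w t)) (fderiv ℝ V (w t) (τ • extendIcc (V.comp u) t)) t :=
      (hV.differentiable (by simp) (w t)).hasFDerivAt.comp_hasDerivAt t (hw t)
    have h2 : HasDerivAt (fun t => t • V (w t)) _ t := (hasDerivAt_id t).smul h1
    convert h2 using 1
    have e1 := extendIcc_coe (linearizedComp V hV u z) ⟨t, ht⟩
    have e2 := extendIcc_coe (V.comp u) ⟨t, ht⟩
    have e3 := hwu ⟨t, ht⟩
    simp only at e1 e2 e3
    rw [e1, e2, e3]
    simp only [linearizedComp_apply, hz, ContinuousMap.comp_apply, map_smul, id, one_smul]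
    rw [smul_comm]
  have hc1 := continuous_extendIcc (linearizedComp V hV u z)
  have hc2 := continuous_extendIcc (V.comp u)
  have hint := intervalIntegral.integral_eq_sub_of_hasDerivAt (a := 0) (b := (t : ℝ))
    (f := fun t => t • V (w t)) (fun s hs => hD s (by
      rw [uIcc_of_le t.2.1] at hs
      exact ⟨hs.1, hs.2.trans t.2.2⟩))
    (((hc1.const_smul τ).add hc2).intervalIntegrable _ _)
  rw [intervalIntegral.integral_add (f := fun s => τ • extendIcc (linearizedComp V hV u z) s)
    ((hc1.const_smul τ).intervalIntegrable _ _) (hc2.intervalIntegrable _ _), intervalIntegral.integral_smul, zero_smul, sub_zero, hwu] at hint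
  rw [hint, sub_self]

/-- The flow of a smooth vector field `V` exists near `(0, x₀)` and is smooth there. -/
theorem exists_flow_of_contDiff {V : E → E} (hV : ContDiff ℝ ∞ V) (x₀ : E) :
    ∃ φ : ℝ × E → E, φ (0, x₀) = x₀ ∧ ∀ᶠ p in 𝓝 ((0 : ℝ), x₀), ContDiffAt ℝ ∞ φ p ∧
      HasDerivAt (fun t => φ (t, p.2)) (V (φ p)) p.1 ∧ (p.1 = 0 → φ p = p.2) := by
  set V' : C(E, E) := ⟨V, hV.continuous⟩
  have hV' : ContDiff ℝ ∞ V' := hV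
  have hG := contDiff_flowEquation hV'
  set u₀ : (ℝ × E) × C(Icc (0 : ℝ) 1, E) := ((0, x₀), constFunCLM E x₀)
  have h0 : flowEquation V' u₀ = 0 := by simp [flowEquation, u₀]
  -- At `τ = 0` the integral term drops out, so the partial derivative in `u` is the identity.
  have hinv : (fderiv ℝ (flowEquation V') u₀ ∘L .inr ℝ (ℝ × E) C(Icc (0 : ℝ) 1, E)).IsInvertible := by
    refine ⟨ContinuousLinearEquiv.refl ℝ _, ?_⟩
    ext1 a
    simp [fderiv_flowEquation_apply hV', u₀]
  obtain ⟨ψ, hψ0, hψ⟩ := exists_implicitFunction_eventually_contDiffAt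
    (Filter.Eventually.of_forall fun v => hG.contDiffAt) hinv
  -- Time is rescaled: `u t` is the flow at time `τ t`, so evaluation at `1` gives the flow at time
  -- `τ`.
  let ev : C(Icc (0 : ℝ) 1, E) →L[ℝ] E := ContinuousMap.evalCLM ℝ 1
  refine ⟨fun p => ev (ψ p), by simp [hψ0, u₀, ev], ?_⟩
  filter_upwards [hψ, hψ.eventually_nhds] with p ⟨hp, hs, _, hi⟩ hnear
  rw [h0] at hp
  refine ⟨ev.contDiff.contDiffAt.comp p hs, ?_, ?_⟩
  · let z : C(Icc (0 : ℝ) 1, E) := ⟨fun t => (t : ℝ) • V (ψ p t),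
      continuous_subtype_val.smul (hV.continuous.comp (ψ p).continuous)⟩
    have hz : fderiv ℝ (flowEquation V') (p, ψ p) ((1, 0), z) = 0 :=
      fderiv_flowEquation_smul hV' hp z fun _ => rfl
    have hψd : HasFDerivAt ψ (fderiv ℝ ψ p) p := (hs.differentiableAt (by simp)).hasFDerivAt
    have hd : HasFDerivAt (fun q => flowEquation V' (q, ψ q))
        (fderiv ℝ (flowEquation V') (p, ψ p) ∘L
          ((ContinuousLinearMap.id ℝ (ℝ × E)).prod (fderiv ℝ ψ p))) p :=
      (hG.differentiable (by simp) _).hasFDerivAt.comp p ((hasFDerivAt_id p).prodMk hψd)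
    have hd0 : HasFDerivAt (fun q => flowEquation V' (q, ψ q))
        (0 : ℝ × E →L[ℝ] C(Icc (0 : ℝ) 1, E)) p :=
      (hasFDerivAt_const (0 : C(Icc (0 : ℝ) 1, E)) p).congr_of_eventuallyEq (by
        filter_upwards [hnear] with q hq
        rw [hq.1, h0])
    have hw : fderiv ℝ (flowEquation V') (p, ψ p) ((1, 0), fderiv ℝ ψ p (1, 0)) = 0 := by
      have := DFunLike.congr_fun (hd.unique hd0) ((1 : ℝ), (0 : E))
      simpa using this
    -- Both sides solve the equation linearized in the direction of `τ`, and its partial derivative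
    -- in `u` is injective at this point.
    have heq : fderiv ℝ ψ p (1, 0) = z := by
      obtain ⟨e, he⟩ := hi
      apply e.injective
      have hzw := congrArg₂ (· - ·) hw hz
      simp only [← map_sub, sub_zero] at hzw
      rw [← sub_eq_zero, ← map_sub]
      have := DFunLike.congr_fun he (fderiv ℝ ψ p (1, 0) - z)
      refine this.trans ?_
      simpa using hzw
    have hline : HasDerivAt (fun t : ℝ => (t, p.2)) ((1 : ℝ), (0 : E)) p.1 :=
      (hasDerivAt_id _).prodMk (hasDerivAt_const _ _)
    have : HasDerivAt (fun t => ev (ψ (t, p.2))) _ p.1 :=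
      ev.hasFDerivAt.comp_hasDerivAt p.1 (hψd.comp_hasDerivAt p.1 hline)
    convert this using 1
    rw [heq]
    simp [ev, z]
  · intro hp0
    have := DFunLike.congr_fun hp 1
    obtain ⟨τ, x⟩ := p
    simp only at hp0
    subst hp0
    simpa [flowEquation, sub_eq_zero, ev] using this

/-- A vector field that is smooth near `x₀` has a smooth local flow. -/
theorem exists_flow [FiniteDimensional ℝ E] {Y : E → E} {x₀ : E}
    (hY : ∀ᶠ x in 𝓝 x₀, ContDiffAt ℝ ∞ Y x) :
    ∃ φ : ℝ × E → E, φ (0, x₀) = x₀ ∧ ∀ᶠ p in 𝓝 ((0 : ℝ), x₀), ContDiffAt ℝ ∞ φ p ∧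
      HasDerivAt (fun t => φ (t, p.2)) (Y (φ p)) p.1 ∧ (p.1 = 0 → φ p = p.2) := by
  obtain ⟨r, hr, hr'⟩ := Metric.nhds_basis_closedBall.eventually_iff.1 hY
  -- The cut-off field is smooth everywhere and equals `Y` near `x₀`, where the flow stays for
  -- initial data close to `(0, x₀)`.
  let χ : ContDiffBump x₀ := ⟨r / 2, r, by positivity, by linarith⟩
  have hV : ContDiff ℝ ∞ (fun x => χ x • Y x) := by
    refine contDiff_iff_contDiffAt.2 fun x => ?_
    by_cases hx : x ∈ tsupport χ
    · rw [χ.tsupport_eq] at hx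
      exact χ.contDiffAt.smul (hr' hx)
    · refine (contDiffAt_const (c := (0 : E))).congr_of_eventuallyEq ?_
      filter_upwards [notMem_tsupport_iff_eventuallyEq.1 hx] with y hy
      simp [hy]
  obtain ⟨φ, h0, hφ⟩ := exists_flow_of_contDiff hV x₀
  refine ⟨φ, h0, ?_⟩
  have hc : Filter.Tendsto φ (𝓝 ((0 : ℝ), x₀)) (𝓝 x₀) := by
    have := hφ.self_of_nhds.1.continuousAt.tendsto
    rwa [h0] at this
  filter_upwards [hφ, hc.eventually χ.eventuallyEq_one] with p hp h1
  refine ⟨hp.1, ?_, hp.2.2⟩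
  have := hp.2.1
  simp only [h1, Pi.one_apply, one_smul] at this
  exact this

end Flow

/-! ### Commuting vector fields and their common first integrals -/

section Commuting

variable {E : Type*} [NormedAddCommGroup E] [NormedSpace ℝ E]

/-- `φ` is a smooth local flow of `Y` near `x₀`. -/
structure IsLocalFlowAt (Y : E → E) (x₀ : E) (φ : ℝ × E → E) : Prop where
  apply_zero : φ (0, x₀) = x₀
  eventually_flow : ∀ᶠ p in 𝓝 ((0 : ℝ), x₀), ContDiffAt ℝ ∞ φ p ∧
      HasDerivAt (fun t => φ (t, p.2)) (Y (φ p)) p.1 ∧ (p.1 = 0 → φ p = p.2)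

theorem two_le_contDiff_infty : (2 : WithTop ℕ∞) ≤ ∞ :=
  WithTop.coe_le_coe.2 (le_top : (2 : ℕ∞) ≤ ⊤)

namespace IsLocalFlowAt

variable {Y : E → E} {x₀ : E} {φ : ℝ × E → E}

theorem tendsto (h : IsLocalFlowAt Y x₀ φ) :
    Filter.Tendsto φ (𝓝 ((0 : ℝ), x₀)) (𝓝 x₀) := by
  have := h.eventually_flow.self_of_nhds.1.continuousAt.tendsto
  rwa [h.apply_zero] at this

theorem eventually_fderiv_time (h : IsLocalFlowAt Y x₀ φ) :
    ∀ᶠ p in 𝓝 ((0 : ℝ), x₀), fderiv ℝ φ p (1, 0) = Y (φ p) := by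
  filter_upwards [h.eventually_flow] with p hp
  have hline : HasDerivAt (fun t : ℝ => (t, p.2)) ((1 : ℝ), (0 : E)) p.1 :=
    (hasDerivAt_id _).prodMk (hasDerivAt_const _ _)
  have : HasDerivAt (fun t => φ (t, p.2)) _ p.1 :=
    (hp.1.differentiableAt (by simp)).hasFDerivAt.comp_hasDerivAt p.1 hline
  exact this.unique hp.2.1

theorem eventually_fderiv_zero (h : IsLocalFlowAt Y x₀ φ) :
    ∀ᶠ x in 𝓝 x₀, ∀ v, fderiv ℝ φ (0, x) (0, v) = v := by
  have hc : Filter.Tendsto (fun x : E => ((0 : ℝ), x)) (𝓝 x₀) (𝓝 (0, x₀)) :=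
    (Continuous.prodMk_right (0 : ℝ)).tendsto x₀
  filter_upwards [hc.eventually h.eventually_flow, (hc.eventually h.eventually_flow).eventually_nhds]
    with x hx hx' v
  have h1 : HasFDerivAt (fun y => φ (0, y)) (fderiv ℝ φ (0, x) ∘L .inr ℝ ℝ E) x :=
    (hx.1.differentiableAt (by simp)).hasFDerivAt.comp x (hasFDerivAt_prodMk_right (0 : ℝ) x)
  have h2 : HasFDerivAt (fun y => φ (0, y)) (ContinuousLinearMap.id ℝ E) x :=
    (hasFDerivAt_id x).congr_of_eventuallyEq (by
      filter_upwards [hx'] with y hy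
      exact hy.2.2 rfl)
  exact DFunLike.congr_fun (h1.unique h2) v

/-- The flow of `Y` preserves every vector field that commutes with `Y`. -/
theorem eventually_fderiv_of_commute (h : IsLocalFlowAt Y x₀ φ)
    (hY : ∀ᶠ x in 𝓝 x₀, ContDiffAt ℝ ∞ Y x) {Z : E → E} (hZ : ∀ᶠ x in 𝓝 x₀, ContDiffAt ℝ ∞ Z x)
    (hYZ : ∀ᶠ x in 𝓝 x₀, fderiv ℝ Y x (Z x) = fderiv ℝ Z x (Y x)) :
    ∀ᶠ p in 𝓝 ((0 : ℝ), x₀), fderiv ℝ φ p (0, Z p.2) = Z (φ p) := by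
  -- Along a trajectory, the transported vector and `Z ∘ φ` both solve the linear equation `y' =
  -- DY(φ) y` with the same initial value; `K` is the Lipschitz constant for uniqueness.
  obtain ⟨K, hK⟩ : ∃ K : NNReal, ∀ᶠ x in 𝓝 x₀, ‖fderiv ℝ Y x‖₊ ≤ K := by
    have hc : ContinuousAt (fun x => ‖fderiv ℝ Y x‖₊) x₀ :=
      (hY.self_of_nhds.fderiv_right (m := 0) (by simp)).continuousAt.nnnorm
    exact ⟨‖fderiv ℝ Y x₀‖₊ + 1, (hc.eventually (gt_mem_nhds (lt_add_one _))).mono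
      fun x hx => le_of_lt hx⟩
  have hx2 : Filter.Tendsto (fun p : ℝ × E => p.2) (𝓝 ((0 : ℝ), x₀)) (𝓝 x₀) :=
    continuous_snd.tendsto ((0 : ℝ), x₀)
  have hall := (((h.eventually_flow.and (h.eventually_fderiv_time.eventually_nhds)).and
    (h.tendsto.eventually (hY.and (hZ.and (hYZ.and hK))))).and
    (hx2.eventually h.eventually_fderiv_zero))
  obtain ⟨ε, hε, hball⟩ := Metric.eventually_nhds_iff.1 hall
  refine Metric.eventually_nhds_iff.2 ⟨ε, hε, ?_⟩
  rintro ⟨t, x⟩ htx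
  rw [Prod.dist_eq, max_lt_iff] at htx
  obtain ⟨ht, hx⟩ := htx
  have hmem : ∀ s ∈ Ioo (-ε) ε, dist (s, x) ((0 : ℝ), x₀) < ε := by
    intro s hs
    rw [Prod.dist_eq, max_lt_iff]
    refine ⟨?_, hx⟩
    rw [Real.dist_eq, sub_zero]
    exact abs_lt.2 hs
  have ht' : t ∈ Ioo (-ε) ε := by
    rw [Real.dist_eq, sub_zero] at ht
    exact abs_lt.1 ht
  have h0' : (0 : ℝ) ∈ Ioo (-ε) ε := ⟨by linarith, hε⟩
  have hline : ∀ s : ℝ, HasDerivAt (fun t : ℝ => (t, x)) ((1 : ℝ), (0 : E)) s := fun s =>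
    (hasDerivAt_id _).prodMk (hasDerivAt_const _ _)
  -- Symmetry of the second derivative exchanges `∂_s` with the derivative along `Z x`, and `∂_s φ =
  -- Y ∘ φ`.
  have hD1 : ∀ s ∈ Ioo (-ε) ε, HasDerivAt (fun s => fderiv ℝ φ (s, x) (0, Z x))
      (fderiv ℝ Y (φ (s, x)) (fderiv ℝ φ (s, x) (0, Z x))) s := by
    intro s hs
    obtain ⟨⟨⟨hf, htime⟩, hYs, -⟩, -⟩ := hball (hmem s hs)
    have hd2 : HasFDerivAt (fderiv ℝ φ) (fderiv ℝ (fderiv ℝ φ) (s, x)) (s, x) :=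
      ((hf.1.fderiv_right (m := 1)
        (one_add_one_eq_two.trans_le two_le_contDiff_infty)).differentiableAt one_ne_zero).hasFDerivAt
    have hsymm := (hf.1.isSymmSndFDerivAt (by simpa using two_le_contDiff_infty)).eq
      ((1 : ℝ), (0 : E)) ((0 : ℝ), Z x)
    have h1 : HasDerivAt (fun s => fderiv ℝ φ (s, x)) (fderiv ℝ (fderiv ℝ φ) (s, x) (1, 0)) s :=
      hd2.comp_hasDerivAt s (hline s)
    have h2 : HasFDerivAt (fun q => fderiv ℝ φ q (1, 0))
        ((fderiv ℝ (fderiv ℝ φ) (s, x)).flip (1, 0)) (s, x) := by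
      simpa using hd2.clm_apply (hasFDerivAt_const ((1 : ℝ), (0 : E)) (s, x))
    have h3 : HasFDerivAt (fun q => fderiv ℝ φ q (1, 0))
        (fderiv ℝ Y (φ (s, x)) ∘L fderiv ℝ φ (s, x)) (s, x) :=
      ((hYs.differentiableAt (by simp)).hasFDerivAt.comp (s, x)
        (hf.1.differentiableAt (by simp)).hasFDerivAt).congr_of_eventuallyEq htime
    have h4 := DFunLike.congr_fun (h2.unique h3) ((0 : ℝ), Z x)
    have h5 := h1.clm_apply (hasDerivAt_const s ((0 : ℝ), Z x))
    simp only [ContinuousLinearMap.flip_apply, ContinuousLinearMap.comp_apply] at h4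
    rw [hsymm, h4, map_zero, add_zero] at h5
    exact h5
  have hD2 : ∀ s ∈ Ioo (-ε) ε, HasDerivAt (fun s => Z (φ (s, x)))
      (fderiv ℝ Y (φ (s, x)) (Z (φ (s, x)))) s := by
    intro s hs
    obtain ⟨⟨⟨hf, -⟩, -, hZs, hcomm, -⟩, -⟩ := hball (hmem s hs)
    rw [hcomm]
    exact (hZs.differentiableAt (by simp)).hasFDerivAt.comp_hasDerivAt s hf.2.1
  refine ODE_solution_unique_of_mem_Ioo (v := fun s y => fderiv ℝ Y (φ (s, x)) y)
    (s := fun _ => univ) (K := K) (f := fun s => fderiv ℝ φ (s, x) (0, Z x))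
    (g := fun s => Z (φ (s, x))) (fun s hs => ?_) h0' (fun s hs => ⟨hD1 s hs, mem_univ _⟩)
    (fun s hs => ⟨hD2 s hs, mem_univ _⟩) ?_ ht'
  · obtain ⟨⟨-, -, -, -, hKs⟩, -⟩ := hball (hmem s hs)
    exact ((fderiv ℝ Y (φ (s, x))).lipschitz.weaken hKs).lipschitzOnWith
  · obtain ⟨⟨⟨hf, -⟩, -⟩, hz⟩ := hball (hmem 0 h0')
    simp only [hz, hf.2.2]

end IsLocalFlowAt

theorem isInvertible_toSpanSingleton {c : ℝ} (hc : c ≠ 0) {L : ℝ →L[ℝ] ℝ} (hL : L 1 = c) :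
    L.IsInvertible := by
  refine ⟨ContinuousLinearEquiv.unitsEquivAut ℝ (Units.mk0 c hc), ?_⟩
  ext
  simp [hL]

/-- Given independent commuting vector fields `Y a` near `x₀`, every covector at `x₀` that
annihilates all `Y a x₀` is the differential of a common first integral of the `Y a`. -/
theorem exists_common_firstIntegral [FiniteDimensional ℝ E] {x₀ : E} {j : ℕ} (Y : Fin j → E → E)
    (hY : ∀ a, ∀ᶠ x in 𝓝 x₀, ContDiffAt ℝ ∞ (Y a) x)
    (hcomm : ∀ a b, ∀ᶠ x in 𝓝 x₀, fderiv ℝ (Y a) x (Y b x) = fderiv ℝ (Y b) x (Y a x))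
    (hli : LinearIndependent ℝ (fun a => Y a x₀)) (α : E →L[ℝ] ℝ) (hα : ∀ a, α (Y a x₀) = 0) :
    ∃ g : E → ℝ, (∀ᶠ x in 𝓝 x₀, ContDiffAt ℝ ∞ g x ∧ ∀ a, fderiv ℝ g x (Y a x) = 0) ∧
      fderiv ℝ g x₀ = α := by
  induction j generalizing α with
  | zero =>
    exact ⟨α, Filter.Eventually.of_forall fun x => ⟨α.contDiff.contDiffAt, fun a => a.elim0⟩,
      α.fderiv⟩
  | succ j ih =>
    have hli' := linearIndependent_finSucc.1 hli
    have ih' := ih (fun a => Y a.succ) (fun a => hY _) (fun a b => hcomm _ _) hli'.1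
    -- This covector kills the other fields but not `Y 0`, so the first integral `s` it produces has
    -- level sets transverse to `Y 0`.
    obtain ⟨β₀, hβ0, hβ⟩ := Submodule.exists_le_ker_of_notMem hli'.2
    set β : E →L[ℝ] ℝ := LinearMap.toContinuousLinearMap β₀
    have hβs : ∀ a : Fin j, β (Y a.succ x₀) = 0 := fun a =>
      hβ (Submodule.subset_span ⟨a, rfl⟩)
    obtain ⟨g₀, hg₀, hdg₀⟩ := ih' α (fun a => hα _)
    obtain ⟨s, hs, hds⟩ := ih' β hβs
    obtain ⟨φ, hφ₁, hφ₂⟩ := exists_flow (hY 0)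
    have hφ : IsLocalFlowAt (Y 0) x₀ φ := ⟨hφ₁, hφ₂⟩
    have htr : ∀ᶠ p in 𝓝 ((0 : ℝ), x₀), ∀ a, fderiv ℝ φ p (0, Y a p.2) = Y a (φ p) :=
      Filter.eventually_all.2 fun a =>
        hφ.eventually_fderiv_of_commute (hY 0) (hY a) (hcomm 0 a)
    have hswap : Filter.Tendsto (Prod.swap : E × ℝ → ℝ × E) (𝓝 (x₀, (0 : ℝ))) (𝓝 (0, x₀)) :=
      continuous_swap.tendsto (x₀, (0 : ℝ))
    set f : E × ℝ → ℝ := fun q => s (φ q.swap)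
    have hf : ∀ᶠ q in 𝓝 (x₀, (0 : ℝ)), ContDiffAt ℝ ∞ f q := by
      filter_upwards [hswap.eventually hφ.eventually_flow,
        hswap.eventually (hφ.tendsto.eventually hs)] with q h1 h2
      exact h2.1.comp q (h1.1.comp q (contDiff_snd.prodMk contDiff_fst).contDiffAt)
    have hc : fderiv ℝ f (x₀, 0) (0, 1) = β (Y 0 x₀) := by
      have h1 : HasFDerivAt s β (φ (Prod.swap (x₀, (0 : ℝ)))) := by
        simp only [Prod.swap_prod_mk, hφ.apply_zero]
        rw [← hds]
        exact (hs.self_of_nhds.1.differentiableAt (by simp)).hasFDerivAt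
      have h2 : HasFDerivAt φ (fderiv ℝ φ (0, x₀)) (Prod.swap (x₀, (0 : ℝ))) :=
        (hφ.eventually_flow.self_of_nhds.1.differentiableAt (by simp)).hasFDerivAt
      have h3 : HasFDerivAt f _ (x₀, (0 : ℝ)) :=
        h1.comp (x₀, (0 : ℝ)) (h2.comp (x₀, (0 : ℝ)) (hasFDerivAt_snd.prodMk hasFDerivAt_fst))
      rw [h3.fderiv]
      have := hφ.eventually_fderiv_time.self_of_nhds
      rw [hφ.apply_zero] at this
      simp [this]
    -- `τ x` is the time the flow of `Y 0` takes to carry `x` to the level set `s = s x₀`; `θ` is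
    -- the resulting projection onto it.
    obtain ⟨τ, hτ0, hτ⟩ := exists_implicitFunction_eventually_contDiffAt hf
      (isInvertible_toSpanSingleton (c := β (Y 0 x₀)) hβ0 (by simpa using hc))
    simp only at hτ0 hτ
    have hτs : ContDiffAt ℝ ∞ τ x₀ := hτ.self_of_nhds.2.1
    set θ : E → E := fun x => φ (τ x, x)
    have hpair : Filter.Tendsto (fun x => (τ x, x)) (𝓝 x₀) (𝓝 (0, x₀)) := by
      have := (hτs.continuousAt.prodMk continuousAt_id).tendsto
      rwa [hτ0] at this
    have hθ0 : θ x₀ = x₀ := by simp [θ, hτ0, hφ.apply_zero]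
    have hθ : Filter.Tendsto θ (𝓝 x₀) (𝓝 x₀) := hφ.tendsto.comp hpair
    have hdθ : ∀ᶠ x in 𝓝 x₀, ContDiffAt ℝ ∞ θ x ∧ HasFDerivAt θ
        (fderiv ℝ φ (τ x, x) ∘L (fderiv ℝ τ x).prod (ContinuousLinearMap.id ℝ E)) x := by
      filter_upwards [hτ, hpair.eventually hφ.eventually_flow] with x h1 h2
      refine ⟨h2.1.comp x (f := fun x => (τ x, x)) (h1.2.1.prodMk contDiffAt_id), ?_⟩
      exact (h2.1.differentiableAt (by simp)).hasFDerivAt.comp x (f := fun x => (τ x, x))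
        ((h1.2.1.differentiableAt (by simp)).hasFDerivAt.prodMk (hasFDerivAt_id x))
    have hsplit : ∀ᶠ x in 𝓝 x₀, ∀ v, fderiv ℝ θ x v =
        fderiv ℝ τ x v • Y 0 (θ x) + fderiv ℝ φ (τ x, x) (0, v) := by
      filter_upwards [hdθ, hpair.eventually hφ.eventually_fderiv_time] with x h1 h2 v
      rw [h1.2.fderiv, ← h2, ← map_smul, ← map_add]
      simp
    have hne : ∀ᶠ x in 𝓝 x₀, fderiv ℝ s x (Y 0 x) ≠ 0 := by
      have : ContinuousAt (fun x => fderiv ℝ s x (Y 0 x)) x₀ :=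
        (hs.self_of_nhds.1.fderiv_right (m := 0) (by simp)).continuousAt.clm_apply
          (hY 0).self_of_nhds.continuousAt
      refine this.eventually_ne ?_
      rw [hds]
      exact hβ0
    refine ⟨fun x => g₀ (θ x), ?_, ?_⟩
    · filter_upwards [hdθ, hsplit, hθ.eventually hne, hθ.eventually hg₀, hθ.eventually hs,
        hτ.eventually_nhds, hpair.eventually htr] with x h1 h2 h3 h4 h5 h6 h7
      have hsθ : ∀ v, fderiv ℝ s (θ x) (fderiv ℝ θ x v) = 0 := by
        intro v
        have e1 : HasFDerivAt (fun x => s (θ x)) (fderiv ℝ s (θ x) ∘L fderiv ℝ θ x) x :=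
          (h5.1.differentiableAt (by simp)).hasFDerivAt.comp x
            (h1.1.differentiableAt (by simp)).hasFDerivAt
        have e2 : HasFDerivAt (fun x => s (θ x)) (0 : E →L[ℝ] ℝ) x :=
          (hasFDerivAt_const (f (x₀, 0)) x).congr_of_eventuallyEq (by
            filter_upwards [h6] with y hy
            exact hy.1)
        exact DFunLike.congr_fun (e1.unique e2) v
      refine ⟨h4.1.comp x h1.1, fun a => ?_⟩
      have e3 : HasFDerivAt (fun x => g₀ (θ x)) (fderiv ℝ g₀ (θ x) ∘L fderiv ℝ θ x) x :=
        (h4.1.differentiableAt (by simp)).hasFDerivAt.comp x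
          (h1.1.differentiableAt (by simp)).hasFDerivAt
      rw [e3.fderiv, ContinuousLinearMap.comp_apply]
      -- The flow preserves `Y a`, so `dθ (Y a) = dτ (Y a) • Y 0 + Y a` at `θ x`. Constancy of `s ∘
      -- θ` forces `dτ (Y a)` to be `-1` for `a = 0` and `0` otherwise.
      have hv := h2 (Y a x)
      rw [h7 a] at hv
      change _ = _ • Y 0 (θ x) + Y a (θ x) at hv
      have hsv := hsθ (Y a x)
      rw [hv, map_add, map_smul, smul_eq_mul] at hsv
      rw [hv, map_add, map_smul, smul_eq_mul]
      cases a using Fin.cases with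
      | zero =>
        rw [← add_one_mul] at hsv ⊢
        rw [(mul_eq_zero.1 hsv).resolve_right h3, zero_mul]
      | succ b =>
        rw [h5.2 b, add_zero] at hsv
        rw [(mul_eq_zero.1 hsv).resolve_right h3, h4.2 b, zero_mul, add_zero]
    · have e1 : HasFDerivAt (fun x => g₀ (θ x)) (fderiv ℝ g₀ x₀ ∘L fderiv ℝ θ x₀) x₀ := by
        refine HasFDerivAt.comp x₀ ?_ (hdθ.self_of_nhds.1.differentiableAt (by simp)).hasFDerivAt
        rw [hθ0]
        exact (hg₀.self_of_nhds.1.differentiableAt (by simp)).hasFDerivAt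
      rw [e1.fderiv]
      ext v
      -- At `x₀` the differential of `θ` differs from the identity only by multiples of `Y 0 x₀`,
      -- which `α` kills.
      have := hsplit.self_of_nhds v
      rw [hτ0, hθ0, hφ.eventually_fderiv_zero.self_of_nhds] at this
      rw [ContinuousLinearMap.comp_apply, this, map_add, map_smul, hdg₀, hα, smul_zero, zero_add]

end Commuting

/-! ### Hamiltonian vector fields of a symplectic form on a vector space -/

section LocalSymplectic

variable {E : Type*} [NormedAddCommGroup E] [NormedSpace ℝ E]

/-- A smooth family of non-degenerate closed skew-symmetric bilinear forms near `x₀`. -/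
structure IsSymplecticNear (B : E → E →L[ℝ] E →L[ℝ] ℝ) (x₀ : E) : Prop where
  smooth : ∀ᶠ x in 𝓝 x₀, ContDiffAt ℝ ∞ B x
  skew : ∀ᶠ x in 𝓝 x₀, ∀ v w, B x v w = -B x w v
  closed : ∀ᶠ x in 𝓝 x₀, ∀ u v w,
    fderiv ℝ B x u v w - fderiv ℝ B x v u w + fderiv ℝ B x w u v = 0
  nondegenerate : ∀ v, B x₀ v = 0 → v = 0

/-- The Hamiltonian vector field of `f`: the solution of `B x (X x) = df`. -/
def hamiltonianField (B : E → E →L[ℝ] E →L[ℝ] ℝ) (f : E → ℝ) (x : E) : E :=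
  (B x).inverse (fderiv ℝ f x)

namespace IsSymplecticNear

variable {B : E → E →L[ℝ] E →L[ℝ] ℝ} {x₀ : E}

theorem skew_apply_self (hB : IsSymplecticNear B x₀) :
    ∀ᶠ x in 𝓝 x₀, ∀ v, B x v v = 0 := by
  filter_upwards [hB.skew] with x hx v
  linarith [hx v v]

/-- Hamiltonian vector fields of functions in involution commute. -/
theorem eventually_fderiv_comm (hB : IsSymplecticNear B x₀)
    (hinj : ∀ᶠ x in 𝓝 x₀, ∀ v, B x v = 0 → v = 0) {f g : E → ℝ} {X Y : E → E}
    (hf : ∀ᶠ x in 𝓝 x₀, ContDiffAt ℝ ∞ f x) (hg : ∀ᶠ x in 𝓝 x₀, ContDiffAt ℝ ∞ g x)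
    (hX : ∀ᶠ x in 𝓝 x₀, ContDiffAt ℝ ∞ X x) (hY : ∀ᶠ x in 𝓝 x₀, ContDiffAt ℝ ∞ Y x)
    (hXf : ∀ᶠ x in 𝓝 x₀, B x (X x) = fderiv ℝ f x)
    (hYg : ∀ᶠ x in 𝓝 x₀, B x (Y x) = fderiv ℝ g x)
    (hXY : ∀ᶠ x in 𝓝 x₀, B x (X x) (Y x) = 0) :
    ∀ᶠ x in 𝓝 x₀, fderiv ℝ X x (Y x) = fderiv ℝ Y x (X x) := by
  filter_upwards [hB.smooth, hB.skew, hB.skew.eventually_nhds, hB.closed, hinj, hf, hg, hX, hY,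
    hXf.eventually_nhds, hYg.eventually_nhds, hXY.eventually_nhds]
    with x hBs hsk hsk' hcl hinj hf hg hX hY hXf hYg hXY
  have dB : HasFDerivAt B (fderiv ℝ B x) x := (hBs.differentiableAt (by simp)).hasFDerivAt
  have dX : HasFDerivAt X (fderiv ℝ X x) x := (hX.differentiableAt (by simp)).hasFDerivAt
  have dY : HasFDerivAt Y (fderiv ℝ Y x) x := (hY.differentiableAt (by simp)).hasFDerivAt
  have key : ∀ {f : E → ℝ} {X : E → E}, ContDiffAt ℝ ∞ f x → HasFDerivAt X (fderiv ℝ X x) x →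
      (∀ᶠ y in 𝓝 x, B y (X y) = fderiv ℝ f y) → ∀ w v,
      fderiv ℝ B x w (X x) v + B x (fderiv ℝ X x w) v = fderiv ℝ (fderiv ℝ f) x w v := by
    intro f X hf dX hXf w v
    have d2 : HasFDerivAt (fderiv ℝ f) (fderiv ℝ (fderiv ℝ f) x) x :=
      ((hf.fderiv_right (m := 1)
        (one_add_one_eq_two.trans_le two_le_contDiff_infty)).differentiableAt
          one_ne_zero).hasFDerivAt
    have := DFunLike.congr_fun (DFunLike.congr_fun
      (((dB.clm_apply dX).congr_of_eventuallyEq (hXf.mono fun y hy => hy.symm)).unique d2) w) v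
    simpa [add_comm] using this
  have symm : ∀ {f : E → ℝ}, ContDiffAt ℝ ∞ f x → ∀ v w,
      fderiv ℝ (fderiv ℝ f) x v w = fderiv ℝ (fderiv ℝ f) x w v := fun hf v w =>
    (hf.isSymmSndFDerivAt (by simpa using two_le_contDiff_infty)).eq v w
  have dskew : ∀ u v w, fderiv ℝ B x u v w = -fderiv ℝ B x u w v := by
    intro u v w
    have h1 : ∀ v w, HasFDerivAt (fun y => B y v w) (((fderiv ℝ B x).flip v).flip w) x := by
      intro v w
      have := (dB.clm_apply (hasFDerivAt_const v x)).clm_apply (hasFDerivAt_const w x)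
      refine this.congr_fderiv ?_
      ext u
      simp
    have := DFunLike.congr_fun (((h1 w v).neg.congr_of_eventuallyEq
      (hsk'.mono fun y hy => hy v w)).unique (h1 v w)) u
    simpa using this.symm
  have hinv : ∀ w, fderiv ℝ B x w (X x) (Y x) + B x (fderiv ℝ X x w) (Y x) +
      B x (X x) (fderiv ℝ Y x w) = 0 := by
    intro w
    have := DFunLike.congr_fun ((((dB.clm_apply dX).clm_apply dY).congr_of_eventuallyEq
      (hXY.mono fun y hy => hy.symm)).unique (hasFDerivAt_const (0 : ℝ) x)) w
    simp only [add_apply, ContinuousLinearMap.comp_apply,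
      ContinuousLinearMap.flip_apply, zero_apply] at this
    linarith
  -- The bracket is tested against `v`. The derivatives of `B X = df`, `B Y = dg` (with symmetric
  -- Hessians) and `B X Y = 0` reduce it to the cyclic sum that closedness annihilates.
  rw [← sub_eq_zero]
  refine hinj _ ?_
  ext v
  rw [map_sub, sub_apply, zero_apply]
  have e1 := key hf dX hXf
  have e2 := key hg dY hYg
  linarith [e1 (Y x) v, e1 v (Y x), e2 (X x) v, e2 v (X x), symm hf v (Y x), symm hg v (X x),
    dskew v (X x) (Y x), hinv v, hsk (X x) (fderiv ℝ Y x v), hcl (X x) (Y x) v]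

variable [FiniteDimensional ℝ E]

theorem isInvertible (hB : IsSymplecticNear B x₀) : (B x₀).IsInvertible := by
  have hdim : Module.finrank ℝ E = Module.finrank ℝ (E →L[ℝ] ℝ) := by
    rw [← (LinearMap.toContinuousLinearMap (𝕜 := ℝ) (E := E) (F' := ℝ)).finrank_eq]
    exact (Subspace.dual_finrank_eq (K := ℝ) (V := E)).symm
  have hinj : Function.Injective (B x₀).toLinearMap :=
    (injective_iff_map_eq_zero _).2 hB.nondegenerate
  refine ⟨(LinearMap.linearEquivOfInjective _ hinj hdim).toContinuousLinearEquiv, ?_⟩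
  ext v w
  rfl

theorem exists_apply_eq (hB : IsSymplecticNear B x₀) (α : E →L[ℝ] ℝ) : ∃ v, B x₀ v = α := by
  obtain ⟨e, he⟩ := hB.isInvertible
  exact ⟨e.symm α, by rw [← he]; simp⟩

theorem eventually_isInvertible (hB : IsSymplecticNear B x₀) :
    ∀ᶠ x in 𝓝 x₀, (B x).IsInvertible := by
  obtain ⟨e, he⟩ := hB.isInvertible
  have := ContinuousLinearEquiv.nhds e
  rw [he] at this
  exact (hB.smooth.self_of_nhds.continuousAt.eventually this).mono fun x ⟨e', he'⟩ => ⟨e', he'⟩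

theorem eventually_injective (hB : IsSymplecticNear B x₀) :
    ∀ᶠ x in 𝓝 x₀, ∀ v, B x v = 0 → v = 0 := by
  filter_upwards [hB.eventually_isInvertible] with x ⟨e, he⟩ v hv
  rw [← he] at hv
  exact (map_eq_zero_iff e e.injective).1 hv

theorem eventually_apply_hamiltonianField (hB : IsSymplecticNear B x₀) (f : E → ℝ) :
    ∀ᶠ x in 𝓝 x₀, B x (hamiltonianField B f x) = fderiv ℝ f x := by
  filter_upwards [hB.eventually_isInvertible] with x ⟨e, he⟩
  rw [hamiltonianField, ← he, ContinuousLinearMap.inverse_equiv]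
  simp

theorem eventually_contDiffAt_hamiltonianField (hB : IsSymplecticNear B x₀) {f : E → ℝ}
    (hf : ∀ᶠ x in 𝓝 x₀, ContDiffAt ℝ ∞ f x) :
    ∀ᶠ x in 𝓝 x₀, ContDiffAt ℝ ∞ (hamiltonianField B f) x := by
  filter_upwards [hB.eventually_isInvertible, hB.smooth, hf] with x ⟨e, he⟩ hs hf
  have h1 : ContDiffAt ℝ ∞ (ContinuousLinearMap.inverse : (E →L[ℝ] E →L[ℝ] ℝ) → _) (B x) := by
    rw [← he]
    exact contDiffAt_map_inverse e
  exact (h1.comp x hs).clm_apply (hf.fderiv_right (by simp))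

/-- An isotropic subspace `W` transverse to a co-isotropic subspace `C` can be enlarged as long as
`W + C` is not everything. -/
theorem exists_notMem_sup (hB : IsSymplecticNear B x₀) {W C : Submodule ℝ E}
    (hC : ∀ v, (∀ w ∈ C, B x₀ v w = 0) → v ∈ C) (hWC : Disjoint W C) (htop : W ⊔ C ≠ ⊤) :
    ∃ w, w ∉ W ⊔ C ∧ ∀ v ∈ W, B x₀ w v = 0 := by
  have hsk := hB.skew.self_of_nhds
  obtain ⟨c, hc0, hc⟩ : ∃ c, c ≠ 0 ∧ ∀ v ∈ W ⊔ C, B x₀ c v = 0 := by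
    obtain ⟨x, hx⟩ : ∃ x, x ∉ W ⊔ C := by
      by_contra! h
      exact htop (eq_top_iff.2 fun x _ => h x)
    obtain ⟨β, hβ, hβ'⟩ := Submodule.exists_le_ker_of_notMem hx
    obtain ⟨c, hc⟩ := hB.exists_apply_eq (LinearMap.toContinuousLinearMap β)
    refine ⟨c, ?_, fun v hv => ?_⟩
    · rintro rfl
      rw [map_zero] at hc
      exact hβ (DFunLike.congr_fun hc x).symm
    · rw [hc]
      exact hβ' hv
  -- Co-isotropy enters here: it places `c` in `C`, so a covector can vanish on `W` and not on `c`.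
  have hcC : c ∈ C := hC c fun w hw => hc w (Submodule.mem_sup_right hw)
  have hcW : c ∉ W := fun h => hc0 (Submodule.disjoint_def.1 hWC c h hcC)
  obtain ⟨μ, hμ, hμ'⟩ := Submodule.exists_le_ker_of_notMem hcW
  obtain ⟨w, hw⟩ := hB.exists_apply_eq (LinearMap.toContinuousLinearMap μ)
  refine ⟨w, fun h => hμ ?_, fun v hv => ?_⟩
  · have := hsk w c
    rw [hc w h, neg_zero, hw] at this
    exact this
  · rw [hw]
    exact hμ' hv

/-- Functions in involution whose Hamiltonian vector fields at `x₀` are independent. -/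
structure IsInvolutive {j : ℕ} (B : E → E →L[ℝ] E →L[ℝ] ℝ) (x₀ : E) (f : Fin j → E → ℝ) : Prop where
  smooth : ∀ a, ∀ᶠ x in 𝓝 x₀, ContDiffAt ℝ ∞ (f a) x
  bracket : ∀ a b, ∀ᶠ x in 𝓝 x₀, B x (hamiltonianField B (f a) x) (hamiltonianField B (f b) x) = 0
  independent : LinearIndependent ℝ fun a => hamiltonianField B (f a) x₀

/-- Covectors that annihilate the Hamiltonian vector fields of functions in involution are
differentials of functions in involution with all of them. -/
theorem exists_firstIntegral (hB : IsSymplecticNear B x₀) {j : ℕ} {f : Fin j → E → ℝ}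
    (hf : IsInvolutive B x₀ f) (α : E →L[ℝ] ℝ)
    (hα : ∀ a, α (hamiltonianField B (f a) x₀) = 0) :
    ∃ g : E → ℝ, (∀ᶠ x in 𝓝 x₀, ContDiffAt ℝ ∞ g x ∧
      ∀ a, fderiv ℝ g x (hamiltonianField B (f a) x) = 0) ∧ fderiv ℝ g x₀ = α :=
  exists_common_firstIntegral _
    (fun a => hB.eventually_contDiffAt_hamiltonianField (hf.smooth a))
    (fun a b => hB.eventually_fderiv_comm hB.eventually_injective (hf.smooth a) (hf.smooth b)
      (hB.eventually_contDiffAt_hamiltonianField (hf.smooth a))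
      (hB.eventually_contDiffAt_hamiltonianField (hf.smooth b))
      (hB.eventually_apply_hamiltonianField _) (hB.eventually_apply_hamiltonianField _)
      (hf.bracket a b)) hf.independent α hα

/-- `h` belongs to a family of functions in involution whose Hamiltonian vector fields span a
subspace of prescribed dimension transverse to the co-isotropic subspace `C`. -/
theorem exists_isInvolutive (hB : IsSymplecticNear B x₀) {h : E → ℝ}
    (hh : ∀ᶠ x in 𝓝 x₀, ContDiffAt ℝ ∞ h x) {C : Submodule ℝ E}
    (hC : ∀ v, (∀ w ∈ C, B x₀ v w = 0) → v ∈ C) (hX : hamiltonianField B h x₀ ∉ C) (j : ℕ)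
    (hj : j + 1 + Module.finrank ℝ C ≤ Module.finrank ℝ E) :
    ∃ f : Fin (j + 1) → E → ℝ, IsInvolutive B x₀ f ∧ (∃ a, f a = h) ∧
      Disjoint (Submodule.span ℝ (range fun a => hamiltonianField B (f a) x₀)) C := by
  induction j with
  | zero =>
    have h0 : hamiltonianField B h x₀ ≠ 0 := fun h0 => hX (h0 ▸ C.zero_mem)
    refine ⟨fun _ => h, ⟨fun _ => hh, fun _ _ => ?_, ?_⟩, ⟨0, rfl⟩, ?_⟩
    · exact hB.skew_apply_self.mono fun x hx => hx _
    · have : Unique (Fin (0 + 1)) := inferInstanceAs (Unique (Fin 1))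
      exact linearIndependent_unique_iff.2 h0
    · rw [range_const, disjoint_comm, Submodule.disjoint_span_singleton' h0]
      exact hX
  | succ j ih =>
    obtain ⟨f, hf, ⟨a, ha⟩, hdis⟩ := ih (by omega)
    set W := Submodule.span ℝ (range fun a => hamiltonianField B (f a) x₀)
    have hfW : Module.finrank ℝ W = j + 1 := by
      rw [finrank_span_eq_card hf.independent, Fintype.card_fin]
    have htop : W ⊔ C ≠ ⊤ := by
      intro htop
      have := Submodule.finrank_sup_add_finrank_inf_eq W C
      rw [htop, hdis.eq_bot, finrank_top, finrank_bot, hfW] at this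
      omega
    obtain ⟨w, hw, hwW⟩ := hB.exists_notMem_sup hC hdis htop
    -- The prescribed differential makes `w` the Hamiltonian vector of `g` at `x₀`; being a first
    -- integral puts `g` in involution with every `f a`.
    obtain ⟨g, hg, hgw⟩ := hB.exists_firstIntegral hf (B x₀ w)
      (fun a => hwW _ (Submodule.subset_span ⟨a, rfl⟩))
    have hgx : hamiltonianField B g x₀ = w := by
      obtain ⟨e, he⟩ := hB.isInvertible
      rw [hamiltonianField, hgw, ← he, ContinuousLinearMap.inverse_equiv]
      simp
    have hgf : ∀ a, ∀ᶠ x in 𝓝 x₀,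
        B x (hamiltonianField B g x) (hamiltonianField B (f a) x) = 0 := by
      intro a
      filter_upwards [hB.eventually_apply_hamiltonianField g, hg] with x h1 h2
      rw [h1, h2.2 a]
    have hcons : (fun a => hamiltonianField B ((Fin.cons g f : Fin (j + 2) → E → ℝ) a) x₀) =
        Fin.cons w (fun a => hamiltonianField B (f a) x₀) := by
      funext a
      cases a using Fin.cases with
      | zero => exact hgx
      | succ b => rfl
    refine ⟨Fin.cons g f, ⟨?_, ?_, ?_⟩, ⟨a.succ, ha⟩, ?_⟩
    · intro a
      cases a using Fin.cases with
      | zero => exact hg.mono fun x hx => hx.1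
      | succ b => exact hf.smooth b
    · intro a b
      cases a using Fin.cases with
      | zero =>
        cases b using Fin.cases with
        | zero => exact hB.skew_apply_self.mono fun x hx => hx _
        | succ b => exact hgf b
      | succ a =>
        cases b using Fin.cases with
        | zero =>
          filter_upwards [hgf a, hB.skew] with x h1 h2
          simp only [Fin.cons_succ, Fin.cons_zero]
          rw [h2, h1, neg_zero]
        | succ b => exact hf.bracket a b
    · rw [hcons, linearIndependent_finCons]
      exact ⟨hf.independent, fun h => hw (Submodule.mem_sup_left h)⟩
    · rw [hcons, Fin.range_cons, Submodule.span_insert, Submodule.disjoint_def]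
      intro v hv hvC
      obtain ⟨y, hy, z, hz, rfl⟩ := Submodule.mem_sup.1 hv
      obtain ⟨c, rfl⟩ := Submodule.mem_span_singleton.1 hy
      rcases eq_or_ne c 0 with rfl | hc
      · rw [zero_smul, zero_add] at hvC ⊢
        exact Submodule.disjoint_def.1 hdis z hz hvC
      · refine absurd ?_ hw
        have : w = c⁻¹ • ((c • w + z) - z) := by
          rw [add_sub_cancel_right, smul_smul, inv_mul_cancel₀ hc, one_smul]
        rw [this]
        exact Submodule.smul_mem _ _ (Submodule.sub_mem _ (Submodule.mem_sup_right hvC)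
          (Submodule.mem_sup_left hz))

/-- Near a point where the Hamiltonian vector field of `h` is not in the co-isotropic subspace `C`,
it is tangent to the fibres of a submersion with isotropic fibres transverse to `C`. -/
theorem exists_isotropic_submersion (hB : IsSymplecticNear B x₀) {h : E → ℝ}
    (hh : ∀ᶠ x in 𝓝 x₀, ContDiffAt ℝ ∞ h x) {C : Submodule ℝ E}
    (hC : ∀ v, (∀ w ∈ C, B x₀ v w = 0) → v ∈ C) (hX : hamiltonianField B h x₀ ∉ C) {l : ℕ}
    (hl : Module.finrank ℝ C = l) :
    ∃ F : E → EuclideanSpace ℝ (Fin l), (∀ᶠ x in 𝓝 x₀, ContDiffAt ℝ ∞ F x ∧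
        fderiv ℝ F x (hamiltonianField B h x) = 0 ∧ (Function.Surjective (fderiv ℝ F x) →
          ∀ v w, fderiv ℝ F x v = 0 → fderiv ℝ F x w = 0 → B x v w = 0)) ∧
      IsCompl C (LinearMap.ker (fderiv ℝ F x₀).toLinearMap) := by
  have hlt : Module.finrank ℝ C < Module.finrank ℝ E :=
    Submodule.finrank_lt fun htop => hX (htop ▸ Submodule.mem_top)
  -- Here `dim E = l + j + 1`: the family needs `j + 1` members, the codimension of `C`, which is
  -- positive.
  obtain ⟨j, hj⟩ := Nat.exists_eq_add_of_lt hlt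
  obtain ⟨f, hf, ⟨a₀, ha₀⟩, hdis⟩ := hB.exists_isInvolutive hh hC hX j (by omega)
  set W := Submodule.span ℝ (range fun a => hamiltonianField B (f a) x₀)
  have hfW : Module.finrank ℝ W = j + 1 := by
    rw [finrank_span_eq_card hf.independent, Fintype.card_fin]
  obtain ⟨A, hAker⟩ : ∃ A : E →L[ℝ] EuclideanSpace ℝ (Fin l),
      LinearMap.ker A.toLinearMap = W := by
    have hq : Module.finrank ℝ (E ⧸ W) = Module.finrank ℝ (EuclideanSpace ℝ (Fin l)) := by
      have := Submodule.finrank_quotient_add_finrank W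
      rw [finrank_euclideanSpace_fin]
      omega
    refine ⟨LinearMap.toContinuousLinearMap
      ((LinearEquiv.ofFinrankEq _ _ hq).toLinearMap ∘ₗ W.mkQ), ?_⟩
    ext v
    simp
  have hg := fun i : Fin l => hB.exists_firstIntegral hf
    ((EuclideanSpace.proj i : EuclideanSpace ℝ (Fin l) →L[ℝ] ℝ) ∘L A) (fun a => by
      have : hamiltonianField B (f a) x₀ ∈ LinearMap.ker A.toLinearMap :=
        hAker ▸ Submodule.subset_span ⟨a, rfl⟩
      have : A (hamiltonianField B (f a) x₀) = 0 := this
      simp [this])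
  choose g hg hgA using hg
  set F : E → EuclideanSpace ℝ (Fin l) := fun x => WithLp.toLp 2 fun i => g i x
  have hF : ∀ᶠ x in 𝓝 x₀, ContDiffAt ℝ ∞ F x := by
    filter_upwards [Filter.eventually_all.2 hg] with x hx
    exact contDiffAt_euclidean.2 fun i => (hx i).1
  have hdF : ∀ᶠ x in 𝓝 x₀, ∀ v i, fderiv ℝ F x v i = fderiv ℝ (g i) x v := by
    filter_upwards [hF] with x hx v i
    have h1 : HasFDerivAt (fun x => F x i) ((EuclideanSpace.proj i) ∘L fderiv ℝ F x) x :=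
      (EuclideanSpace.proj i : EuclideanSpace ℝ (Fin l) →L[ℝ] ℝ).hasFDerivAt.comp x
        (hx.differentiableAt (by simp)).hasFDerivAt
    have h2 : fderiv ℝ (g i) x = _ := h1.fderiv
    rw [h2]
    rfl
  have hdF0 : fderiv ℝ F x₀ = A := by
    ext v i
    rw [hdF.self_of_nhds, hgA]
    rfl
  have hFX : ∀ᶠ x in 𝓝 x₀, ∀ a, fderiv ℝ F x (hamiltonianField B (f a) x) = 0 := by
    filter_upwards [hdF, Filter.eventually_all.2 hg] with x h1 h2 a
    ext i
    rw [h1, (h2 i).2 a]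
    rfl
  have hli : ∀ᶠ x in 𝓝 x₀, LinearIndependent ℝ fun a => hamiltonianField B (f a) x := by
    have hc : ContinuousAt (fun x a => hamiltonianField B (f a) x) x₀ :=
      continuousAt_pi.2 fun a =>
        (hB.eventually_contDiffAt_hamiltonianField (hf.smooth a)).self_of_nhds.continuousAt
    exact hc.eventually (isOpen_setOfPred_linearIndependent.mem_nhds hf.independent)
  refine ⟨F, ?_, ?_⟩
  · filter_upwards [hF, hFX, hli, Filter.eventually_all.2 fun a => Filter.eventually_all.2
      fun b => hf.bracket a b] with x h1 h2 h3 h4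
    refine ⟨h1, by rw [← ha₀]; exact h2 a₀, fun hs v w hv hw => ?_⟩
    set Wx := Submodule.span ℝ (range fun a => hamiltonianField B (f a) x)
    have hle : Wx ≤ LinearMap.ker (fderiv ℝ F x).toLinearMap := by
      rw [Submodule.span_le]
      rintro _ ⟨a, rfl⟩
      exact h2 a
    -- Independence is an open condition, so the span still has dimension `j + 1`, that of the
    -- kernel of a surjection onto `ℝ^l`.
    have heq : Wx = LinearMap.ker (fderiv ℝ F x).toLinearMap := by
      refine Submodule.eq_of_le_of_finrank_eq hle ?_
      have e1 : Module.finrank ℝ Wx = j + 1 := by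
        rw [finrank_span_eq_card h3, Fintype.card_fin]
      have e2 := LinearMap.finrank_range_add_finrank_ker (fderiv ℝ F x).toLinearMap
      rw [LinearMap.range_eq_top.2 hs, finrank_top, finrank_euclideanSpace_fin] at e2
      omega
    have hv' : v ∈ Wx := heq ▸ hv
    have hw' : w ∈ Wx := heq ▸ hw
    clear hv hw
    induction hv' using Submodule.span_induction with
    | zero => simp
    | add a b _ _ ha hb => rw [map_add, add_apply, ha, hb, add_zero]
    | smul c a _ ha => rw [map_smul, smul_apply, ha, smul_zero]
    | mem v hv' =>
      obtain ⟨a, rfl⟩ := hv'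
      induction hw' using Submodule.span_induction with
      | zero => simp
      | add a b _ _ ha hb => rw [map_add, ha, hb, add_zero]
      | smul c a _ ha => rw [map_smul, ha, smul_zero]
      | mem w hw' =>
        obtain ⟨b, rfl⟩ := hw'
        exact h4 a b
  · rw [hdF0, hAker]
    refine ⟨hdis.symm, codisjoint_iff.2 (Submodule.eq_top_of_finrank_eq ?_)⟩
    have := Submodule.finrank_sup_add_finrank_inf_eq C W
    rw [hdis.symm.eq_bot, finrank_bot, hfW] at this
    omega

end IsSymplecticNear

end LocalSymplectic

/-! ### Local product structures given by transverse submersions -/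

section LocalProduct

variable {E : Type*} [NormedAddCommGroup E] [NormedSpace ℝ E] [FiniteDimensional ℝ E]
  {E₁ : Type*} [NormedAddCommGroup E₁] [NormedSpace ℝ E₁] [FiniteDimensional ℝ E₁]
  {E₂ : Type*} [NormedAddCommGroup E₂] [NormedSpace ℝ E₂] [FiniteDimensional ℝ E₂]

/-- Maps with complementary kernels at `x₀` are the components of a local diffeomorphism, defined
on a neighbourhood on which a given local property holds. -/
theorem exists_openPartialHomeomorph_prodMk {p : E → E₁} {F : E → E₂} {x₀ : E}
    (hp : ∀ᶠ x in 𝓝 x₀, ContDiffAt ℝ ∞ p x) (hF : ∀ᶠ x in 𝓝 x₀, ContDiffAt ℝ ∞ F x)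
    (hker : Disjoint (LinearMap.ker (fderiv ℝ p x₀).toLinearMap)
      (LinearMap.ker (fderiv ℝ F x₀).toLinearMap))
    (hdim : Module.finrank ℝ E = Module.finrank ℝ E₁ + Module.finrank ℝ E₂) {Q : E → Prop}
    (hQ : ∀ᶠ x in 𝓝 x₀, Q x) :
    ∃ e : OpenPartialHomeomorph E (E₁ × E₂), x₀ ∈ e.source ∧ (∀ x, e x = (p x, F x)) ∧
      (∀ x ∈ e.source, Q x ∧ ContDiffAt ℝ ∞ p x ∧ ContDiffAt ℝ ∞ F x ∧
        Function.Surjective (fderiv ℝ F x)) ∧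
      ∀ y ∈ e.target, ContDiffAt ℝ ∞ e.symm y := by
  have hG : ∀ᶠ x in 𝓝 x₀, ContDiffAt ℝ ∞ (fun x => (p x, F x)) x := by
    filter_upwards [hp, hF] with x h1 h2 using h1.prodMk h2
  have hd : ∀ᶠ x in 𝓝 x₀, fderiv ℝ (fun x => (p x, F x)) x = (fderiv ℝ p x).prod (fderiv ℝ F x) := by
    filter_upwards [hp, hF] with x h1 h2
    exact (h1.differentiableAt (by simp)).fderiv_prodMk (h2.differentiableAt (by simp))
  obtain ⟨e', he'⟩ : (fderiv ℝ (fun x => (p x, F x)) x₀).IsInvertible := by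
    have hinj : Function.Injective (fderiv ℝ (fun x => (p x, F x)) x₀).toLinearMap := by
      rw [hd.self_of_nhds]
      refine (injective_iff_map_eq_zero _).2 fun v hv => ?_
      exact Submodule.disjoint_def.1 hker v (congrArg Prod.fst hv) (congrArg Prod.snd hv)
    refine ⟨(LinearMap.linearEquivOfInjective _ hinj
      (by rw [hdim, Module.finrank_prod])).toContinuousLinearEquiv, ?_⟩
    ext1 v
    rfl
  have hinv : ∀ᶠ x in 𝓝 x₀, (fderiv ℝ (fun x => (p x, F x)) x).IsInvertible := by
    have hc : ContinuousAt (fderiv ℝ (fun x => (p x, F x))) x₀ :=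
      (hG.self_of_nhds.fderiv_right (m := 0) (by simp)).continuousAt
    have := ContinuousLinearEquiv.nhds e'
    rw [he'] at this
    exact (hc.eventually this).mono fun x ⟨e, he⟩ => ⟨e, he⟩
  have hG₀ : HasFDerivAt (fun x => (p x, F x)) (e' : E →L[ℝ] E₁ × E₂) x₀ := by
    rw [he']
    exact (hG.self_of_nhds.differentiableAt (by simp)).hasFDerivAt
  set e₀ := hG.self_of_nhds.toOpenPartialHomeomorph _ hG₀ (by simp)
  -- Restricting to an open set where everything holds at each point makes the inverse smooth on the
  -- whole target.
  obtain ⟨O, hO, hOo, hxO⟩ := eventually_nhds_iff.1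
    (((hQ.and hp).and (hF.and hG)).and (hd.and hinv))
  refine ⟨e₀.restrOpen O hOo, ⟨hG.self_of_nhds.mem_toOpenPartialHomeomorph_source hG₀ (by simp),
    hxO⟩, fun x => rfl, fun x hx => ?_, fun y hy => ?_⟩
  · obtain ⟨⟨⟨h1, h2⟩, h3, -⟩, h4, e, he⟩ := hO x hx.2
    refine ⟨h1, h2, h3, fun w => ?_⟩
    obtain ⟨v, hv⟩ := e.surjective (0, w)
    have h5 : fderiv ℝ (fun x => (p x, F x)) x v = (0, w) := by rw [← he]; exact hv
    rw [h4] at h5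
    exact ⟨v, congrArg Prod.snd h5⟩
  · obtain ⟨⟨-, -, h3⟩, -, e, he⟩ := hO _ ((e₀.restrOpen O hOo).map_target hy).2
    refine (e₀.restrOpen O hOo).contDiffAt_symm (f₀' := e) hy ?_ h3
    rw [he]
    exact (h3.differentiableAt (by simp)).hasFDerivAt

end LocalProduct

/-! ### Complete solutions from adapted product neighbourhoods -/

section Adapted

variable {E : Type*} [NormedAddCommGroup E] [NormedSpace ℝ E]
  {B : Type*} [TopologicalSpace B] (I : ModelWithCorners ℝ E B)
  {M : Type*} [TopologicalSpace M] [ChartedSpace B M]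
  {E₁ : Type*} [NormedAddCommGroup E₁] [NormedSpace ℝ E₁]
  {B₁ : Type*} [TopologicalSpace B₁] (J : ModelWithCorners ℝ E₁ B₁)
  {N : Type*} [TopologicalSpace N] [ChartedSpace B₁ N]
  {E₂ : Type*} [NormedAddCommGroup E₂] [NormedSpace ℝ E₂]
  {B₂ : Type*} [TopologicalSpace B₂] (K : ModelWithCorners ℝ E₂ B₂)
  {L : Type*} [TopologicalSpace L] [ChartedSpace B₂ L]

/-- `(P, F) : U → V × A` is a diffeomorphism with inverse `S`. -/
structure IsProductNhd (P : M → N) (F : M → L) (S : N × L → M) (U : Set M) (V : Set N)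
    (A : Set L) : Prop where
  isOpen_U : IsOpen U
  isOpen_V : IsOpen V
  isOpen_A : IsOpen A
  smooth_P : ContMDiffOn I J ∞ P U
  smooth_F : ContMDiffOn I K ∞ F U
  smooth_S : ContMDiffOn (J.prod K) I ∞ S (V ×ˢ A)
  mapsTo : MapsTo (fun x => (P x, F x)) U (V ×ˢ A)
  mapsTo_symm : MapsTo S (V ×ˢ A) U
  left_inv : ∀ x ∈ U, S (P x, F x) = x
  right_inv : ∀ p ∈ V ×ˢ A, (P (S p), F (S p)) = p

namespace IsProductNhd

variable {I J K} {P : M → N} {F : M → L} {S : N × L → M} {U : Set M} {V : Set N} {A : Set L}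

theorem mdifferentiableAt_P (h : IsProductNhd I J K P F S U V A) {x : M} (hx : x ∈ U) :
    MDifferentiableAt I J P x :=
  (h.smooth_P.contMDiffAt (h.isOpen_U.mem_nhds hx)).mdifferentiableAt (by simp)

theorem mdifferentiableAt_F (h : IsProductNhd I J K P F S U V A) {x : M} (hx : x ∈ U) :
    MDifferentiableAt I K F x :=
  (h.smooth_F.contMDiffAt (h.isOpen_U.mem_nhds hx)).mdifferentiableAt (by simp)

theorem prod_mem_nhds (h : IsProductNhd I J K P F S U V A) {p : N × L} (hp : p ∈ V ×ˢ A) :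
    V ×ˢ A ∈ 𝓝 p :=
  (h.isOpen_V.prod h.isOpen_A).mem_nhds hp

theorem mdifferentiableAt_S (h : IsProductNhd I J K P F S U V A) {p : N × L} (hp : p ∈ V ×ˢ A) :
    MDifferentiableAt (J.prod K) I S p :=
  (h.smooth_S.contMDiffAt (h.prod_mem_nhds hp)).mdifferentiableAt (by simp)

theorem exists_eq (h : IsProductNhd I J K P F S U V A) {x : M} (hx : x ∈ U) :
    ∃ p ∈ V ×ˢ A, S p = x :=
  ⟨_, h.mapsTo hx, h.left_inv x hx⟩

theorem mfderiv_P_mfderiv_S (h : IsProductNhd I J K P F S U V A) {p : N × L} (hp : p ∈ V ×ˢ A)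
    (a : E₁ × E₂) :
    (mfderiv I J P (S p) (mfderiv (J.prod K) I S p a) : E₁) = a.1 := by
  have h1 : mfderiv (J.prod K) J (P ∘ S) p = _ :=
    mfderiv_comp p (h.mdifferentiableAt_P (h.mapsTo_symm hp)) (h.mdifferentiableAt_S hp)
  have h2 : (P ∘ S) =ᶠ[𝓝 p] Prod.fst := by
    filter_upwards [h.prod_mem_nhds hp] with q hq
    exact congrArg Prod.fst (h.right_inv q hq)
  have h3 := DFunLike.congr_fun (h1.symm.trans h2.mfderiv_eq) a
  rw [mfderiv_fst] at h3
  exact h3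

theorem mfderiv_F_mfderiv_S (h : IsProductNhd I J K P F S U V A) {p : N × L} (hp : p ∈ V ×ˢ A)
    (a : E₁ × E₂) :
    (mfderiv I K F (S p) (mfderiv (J.prod K) I S p a) : E₂) = a.2 := by
  have h1 : mfderiv (J.prod K) K (F ∘ S) p = _ :=
    mfderiv_comp p (h.mdifferentiableAt_F (h.mapsTo_symm hp)) (h.mdifferentiableAt_S hp)
  have h2 : (F ∘ S) =ᶠ[𝓝 p] Prod.snd := by
    filter_upwards [h.prod_mem_nhds hp] with q hq
    exact congrArg Prod.snd (h.right_inv q hq)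
  have h3 := DFunLike.congr_fun (h1.symm.trans h2.mfderiv_eq) a
  rw [mfderiv_snd] at h3
  exact h3

/-- Together with the two preceding identities, this makes `S_*` and `(P_*, F_*)` mutually inverse,
from which transversality and the Hamilton–Jacobi equation follow. -/
theorem mfderiv_S_mfderiv (h : IsProductNhd I J K P F S U V A) {p : N × L} (hp : p ∈ V ×ˢ A)
    (v : E) :
    (mfderiv (J.prod K) I S p
      ((mfderiv I J P (S p) v : E₁), (mfderiv I K F (S p) v : E₂)) : E) = v := by
  have hx := h.mapsTo_symm hp
  have hq : (P (S p), F (S p)) = p := h.right_inv p hp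
  have hG : MDifferentiableAt I (J.prod K) (fun x => (P x, F x)) (S p) :=
    (h.mdifferentiableAt_P hx).prodMk (h.mdifferentiableAt_F hx)
  have h1 : mfderiv I I (S ∘ fun x => (P x, F x)) (S p) = _ :=
    mfderiv_comp (S p) (h.mdifferentiableAt_S (h.mapsTo hx)) hG
  have h2 : (S ∘ fun x => (P x, F x)) =ᶠ[𝓝 (S p)] id := by
    filter_upwards [h.isOpen_U.mem_nhds hx] with y hy
    exact h.left_inv y hy
  have h3 := DFunLike.congr_fun (h1.symm.trans h2.mfderiv_eq) v
  rw [mfderiv_id, mfderiv_prodMk (h.mdifferentiableAt_P hx) (h.mdifferentiableAt_F hx)] at h3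
  -- The base points `(P (S p), F (S p))` and `p` are equal only propositionally, so the
  -- differential is moved between them by substitution.
  have h4 : ∀ q, q = p → ∀ a : E₁ × E₂,
      (mfderiv (J.prod K) I S q a : E) = mfderiv (J.prod K) I S p a := by
    rintro _ rfl a
    rfl
  exact (h4 _ hq _).symm.trans h3

theorem isSmoothSubmersionOn (h : IsProductNhd I J K P F S U V A) :
    IsSmoothSubmersionOn I K F U where
  smooth := h.smooth_F
  surjective_deriv := by
    intro x hx w
    obtain ⟨p, hp, rfl⟩ := h.exists_eq hx
    exact ⟨_, h.mfderiv_F_mfderiv_S hp ((0 : E₁), (w : E₂))⟩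

theorem isTransverseOn (h : IsProductNhd I J K P F S U V A) : IsTransverseOn I J K P F U := by
  intro x hx
  obtain ⟨p, hp, rfl⟩ := h.exists_eq hx
  constructor
  · rw [Submodule.disjoint_def]
    intro v hv hv'
    have h1 := h.mfderiv_S_mfderiv hp v
    have h2 : (mfderiv I J P (S p) v : E₁) = 0 := hv
    have h3 : (mfderiv I K F (S p) v : E₂) = 0 := hv'
    rw [h2, h3] at h1
    exact h1.symm.trans (map_zero (mfderiv (J.prod K) I S p))
  · rw [codisjoint_iff, eq_top_iff]
    intro v _
    have h1 := h.mfderiv_S_mfderiv hp v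
    set a : E₁ := mfderiv I J P (S p) v
    set b : E₂ := mfderiv I K F (S p) v
    have h2 : v = mfderiv (J.prod K) I S p ((0 : E₁), b) +
        mfderiv (J.prod K) I S p (a, (0 : E₂)) := by
      refine h1.symm.trans (Eq.trans ?_ (map_add (mfderiv (J.prod K) I S p) _ _))
      congr 1
      exact Prod.ext (zero_add a).symm (add_zero b).symm
    rw [h2]
    exact Submodule.add_mem_sup (h.mfderiv_P_mfderiv_S hp _) (h.mfderiv_F_mfderiv_S hp _)

/-- Complete solutions are defined over `P(U)`, so the factor `V` of the box has to be recognised as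
that image. -/
theorem image_P (h : IsProductNhd I J K P F S U V A) (hA : A.Nonempty) : P '' U = V := by
  refine Subset.antisymm (image_subset_iff.2 fun x hx => (h.mapsTo hx).1) fun n hn => ?_
  obtain ⟨a, ha⟩ := hA
  exact ⟨S (n, a), h.mapsTo_symm ⟨hn, ha⟩, congrArg Prod.fst (h.right_inv (n, a) ⟨hn, ha⟩)⟩

theorem image_F (h : IsProductNhd I J K P F S U V A) (hV : V.Nonempty) : F '' U = A := by
  refine Subset.antisymm (image_subset_iff.2 fun x hx => (h.mapsTo hx).2) fun a ha => ?_
  obtain ⟨n, hn⟩ := hV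
  exact ⟨S (n, a), h.mapsTo_symm ⟨hn, ha⟩, congrArg Prod.snd (h.right_inv (n, a) ⟨hn, ha⟩)⟩

theorem invOn (h : IsProductNhd I J K P F S U V A) :
    InvOn S (fun x => (P x, F x)) U (V ×ˢ A) :=
  ⟨h.left_inv, h.right_inv⟩

/-- The inverse of `(P, F)`, as a partial diffeomorphism. -/
def partialDiffeomorph (h : IsProductNhd I J K P F S U V A) :
    PartialDiffeomorph (J.prod K) I (N × L) M ∞ where
  toFun := S
  invFun := fun x => (P x, F x)
  source := V ×ˢ A
  target := U
  map_source' := h.mapsTo_symm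
  map_target' := h.mapsTo
  left_inv' := h.right_inv
  right_inv' := h.left_inv
  open_source := h.isOpen_V.prod h.isOpen_A
  open_target := h.isOpen_U
  contMDiffOn_toFun := h.smooth_S
  contMDiffOn_invFun := h.smooth_P.prodMk h.smooth_F

/-- If the fibres of `F` are tangent to the Hamiltonian vector field, then the inverse of `(P, F)`
is a complete solution. -/
theorem isCompleteSolutionAlong (h : IsProductNhd I J K P F S U V A) (hA : A.Nonempty)
    {Ω : TwoForm I M} {H : M → ℝ} {X : ∀ x : M, TangentSpace I x}
    (hX : ∀ x (v : TangentSpace I x), Ω x ![X x, v] = mfderiv I 𝓘(ℝ, ℝ) H x v)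
    (hXF : ∀ x ∈ U, X x ∈ kerDeriv I K F x) :
    IsCompleteSolutionAlong I J K Ω H X P U A S := by
  refine ⟨h.isOpen_U, h.isOpen_A, ?_, ?_, ?_, ?_⟩ <;> rw [h.image_P hA]
  · exact fun p => ⟨h.partialDiffeomorph, p.2, fun _ _ => rfl⟩
  · exact Subset.antisymm (image_subset_iff.2 h.mapsTo_symm) fun x hx => h.exists_eq hx
  · exact fun p hp => congrArg Prod.fst (h.right_inv p hp)
  · intro p hp v
    -- Since `F_* X = 0`, `S_*` maps the lifted field to `X`, and the equation is the pull-back of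
    -- `i_X Ω = dH`.
    have h1 := h.mfderiv_S_mfderiv hp (X (S p))
    have h2 : (mfderiv I K F (S p) (X (S p)) : E₂) = 0 := hXF _ (h.mapsTo_symm hp)
    rw [h2] at h1
    have h3 : mfderiv (J.prod K) I S p (liftedField I J K X P S p) = X (S p) := h1
    rw [← hX, ← h3]
    change Ω (S p) (mfderiv (J.prod K) I S p ∘ ![_, v]) = _
    congr 1
    funext i
    fin_cases i <;> rfl

/-- If the fibres of `F` are isotropic, then so is the inverse of `(P, F)`. -/
theorem isIsotropicSolutionOn (h : IsProductNhd I J K P F S U V A) {Ω : TwoForm I M}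
    (hF : IsIsotropicMapOn I K Ω F U) : IsIsotropicSolutionOn J Ω V A S := by
  intro a ha n hn
  have hp : (n, a) ∈ V ×ˢ A := ⟨hn, ha⟩
  have h1 : mfderiv J I (S ∘ fun n' : N => (n', a)) n = _ :=
    mfderiv_comp n (h.mdifferentiableAt_S hp)
      (mdifferentiableAt_id.prodMk mdifferentiableAt_const)
  -- The second coordinate is frozen at `a`, so the partial map is tangent to the fibres of `F`.
  have h2 : ∀ v, mfderiv J I (fun n' : N => S (n', a)) n v ∈ kerDeriv I K F (S (n, a)) := by
    intro v
    have h3 := DFunLike.congr_fun h1 v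
    rw [mfderiv_prod_left] at h3
    have h4 : mfderiv J I (fun n' : N => S (n', a)) n v = mfderiv (J.prod K) I S (n, a)
      ((v : E₁), (0 : E₂)) := h3
    rw [h4]
    exact h.mfderiv_F_mfderiv_S hp _
  ext v
  have h5 := hF _ (h.mapsTo_symm hp) (h2 (v 0)) _ (h2 (v 1))
  refine Eq.trans ?_ h5
  change Ω (S (n, a)) (mfderiv J I (fun n' : N => S (n', a)) n ∘ v) = _
  congr 1
  funext i
  fin_cases i <;> rfl

end IsProductNhd

end Adapted

/-! ### Passing to a chart -/

section TwoFormBilinear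

variable {E : Type*} [NormedAddCommGroup E] [NormedSpace ℝ E]

/-- An alternating 2-form as a bilinear map. -/
def alternatingToBilinearCLM (E : Type*) [NormedAddCommGroup E] [NormedSpace ℝ E] :
    (E [⋀^Fin 2]→L[ℝ] ℝ) →L[ℝ] (E →L[ℝ] E →L[ℝ] ℝ) :=
  (ContinuousLinearMap.compL ℝ E (E [×1]→L[ℝ] ℝ) (E →L[ℝ] ℝ)
      (continuousMultilinearCurryFin1 ℝ E ℝ).toContinuousLinearEquiv.toContinuousLinearMap) ∘L
    (continuousMultilinearCurryLeftEquiv ℝ (fun _ : Fin 2 => E)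
      ℝ).toContinuousLinearEquiv.toContinuousLinearMap ∘L
    (ContinuousAlternatingMap.toContinuousMultilinearMapCLM ℝ)

@[simp] theorem alternatingToBilinearCLM_apply (η : E [⋀^Fin 2]→L[ℝ] ℝ) (v w : E) :
    alternatingToBilinearCLM E η v w = η ![v, w] := by
  change η (Fin.cons v (Fin.snoc 0 w)) = _
  congr 1
  funext i
  fin_cases i <;> rfl

theorem hasFDerivAt_alternatingToBilinearCLM (η : E [⋀^Fin 2]→L[ℝ] ℝ) :
    HasFDerivAt (alternatingToBilinearCLM E) (alternatingToBilinearCLM E) η :=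
  ContinuousLinearMap.hasFDerivAt _

theorem contDiff_alternatingToBilinearCLM : ContDiff ℝ ∞ (alternatingToBilinearCLM E) := by
  fun_prop

theorem ContinuousAlternatingMap.apply_pair_swap (η : E [⋀^Fin 2]→L[ℝ] ℝ) (v w : E) :
    η ![v, w] = -η ![w, v] := by
  have h := η.toAlternatingMap.map_swap ![w, v] (i := 0) (j := 1) (by decide)
  have h' : (![w, v] ∘ Equiv.swap (0 : Fin 2) 1) = ![v, w] := by
    funext i
    fin_cases i <;> rfl
  rw [h'] at h
  exact h

/-- The bilinear form of a closed 2-form satisfies the cyclic identity. -/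
theorem fderiv_alternatingToBilinearCLM_cyclic {η : E → E [⋀^Fin 2]→L[ℝ] ℝ} {x : E}
    (hη : DifferentiableAt ℝ η x) (hcl : extDeriv η x = 0) (u v w : E) :
    fderiv ℝ (fun y => alternatingToBilinearCLM E (η y)) x u v w -
      fderiv ℝ (fun y => alternatingToBilinearCLM E (η y)) x v u w +
      fderiv ℝ (fun y => alternatingToBilinearCLM E (η y)) x w u v = 0 := by
  have h1 : fderiv ℝ (fun y => alternatingToBilinearCLM E (η y)) x =
      alternatingToBilinearCLM E ∘L fderiv ℝ η x :=
    (HasFDerivAt.comp (F := E [⋀^Fin 2]→L[ℝ] ℝ) (G := E →L[ℝ] E →L[ℝ] ℝ) x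
      (hasFDerivAt_alternatingToBilinearCLM (η x)) hη.hasFDerivAt).fderiv
  have h2 := DFunLike.congr_fun hcl ![u, v, w]
  rw [extDeriv, ContinuousAlternatingMap.alternatizeUncurryFin_apply, Fin.sum_univ_three] at h2
  have r0 : (0 : Fin 3).removeNth ![u, v, w] = ![v, w] := by funext i; fin_cases i <;> rfl
  have r1 : (1 : Fin 3).removeNth ![u, v, w] = ![u, w] := by funext i; fin_cases i <;> rfl
  have r2 : (2 : Fin 3).removeNth ![u, v, w] = ![u, v] := by funext i; fin_cases i <;> rfl
  rw [r0, r1, r2] at h2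
  simp only [h1, ContinuousLinearMap.comp_apply, alternatingToBilinearCLM_apply]
  simpa [sub_eq_add_neg] using h2

end TwoFormBilinear

section Chart

variable {d : ℕ} {M : Type*} [TopologicalSpace M] [ChartedSpace (EuclideanSpace ℝ (Fin d)) M]
  [IsManifold (𝓡 d) ∞ M]

/-- The bilinear form of a 2-form in a chart. -/
def TwoForm.bilinInChart (Ω : TwoForm (𝓡 d) M) (m : M) (y : EuclideanSpace ℝ (Fin d)) :
    EuclideanSpace ℝ (Fin d) →L[ℝ] EuclideanSpace ℝ (Fin d) →L[ℝ] ℝ :=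
  alternatingToBilinearCLM _ (Ω.inChart m y)

/-- The differential of the chart at `m`, as a linear isomorphism. -/
def chartDeriv (m : M) {x : M} (hx : x ∈ (chartAt (EuclideanSpace ℝ (Fin d)) m).source) :
    EuclideanSpace ℝ (Fin d) ≃L[ℝ] EuclideanSpace ℝ (Fin d) :=
  (mdifferentiable_chart (I := 𝓡 d) m).mfderiv hx

theorem mdifferentiableAt_chart_of_mem {m x : M}
    (hx : x ∈ (chartAt (EuclideanSpace ℝ (Fin d)) m).source) :
    MDifferentiableAt (𝓡 d) (𝓡 d) (chartAt (EuclideanSpace ℝ (Fin d)) m) x :=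
  (mdifferentiable_chart (I := 𝓡 d) m).mdifferentiableAt hx

/-- The coordinate form is a pull-back by the inverse chart, whose differential undoes `chartDeriv`.
Orthogonality relations thus pass between `M` and the chart. -/
theorem bilinInChart_chartDeriv (Ω : TwoForm (𝓡 d) M) {m x : M}
    (hx : x ∈ (chartAt (EuclideanSpace ℝ (Fin d)) m).source) (v w : TangentSpace (𝓡 d) x) :
    Ω.bilinInChart m (chartAt (EuclideanSpace ℝ (Fin d)) m x) (chartDeriv m hx v)
      (chartDeriv m hx w) = Ω x ![v, w] := by
  set c := chartAt (EuclideanSpace ℝ (Fin d)) m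
  have h1 : ∀ v : EuclideanSpace ℝ (Fin d),
      (mfderiv (𝓡 d) (𝓡 d) c.symm (c x) (chartDeriv m hx v) : EuclideanSpace ℝ (Fin d)) = v :=
    fun v => DFunLike.congr_fun ((mdifferentiable_chart (I := 𝓡 d) m).symm_comp_deriv hx) v
  have h2 : ∀ x', x' = x → ∀ v w : EuclideanSpace ℝ (Fin d),
      Ω x' ![(v : TangentSpace (𝓡 d) x'), (w : TangentSpace (𝓡 d) x')] =
      Ω x ![(v : TangentSpace (𝓡 d) x), (w : TangentSpace (𝓡 d) x)] := by
    rintro _ rfl v w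
    rfl
  rw [TwoForm.bilinInChart, alternatingToBilinearCLM_apply]
  refine Eq.trans ?_ (h2 (c.symm (c x)) (c.left_inv hx) v w)
  change Ω (c.symm (c x)) (mfderiv (𝓡 d) (𝓡 d) c.symm (c x) ∘ ![_, _]) = _
  congr 1
  funext i
  fin_cases i
  · exact h1 v
  · exact h1 w

/-- The entry to the local theory on a vector space. Non-degeneracy is needed at the base point
only; it spreads to a neighbourhood by `eventually_isInvertible`. -/
theorem TwoForm.IsSymplectic.isSymplecticNear {Ω : TwoForm (𝓡 d) M} (hΩ : Ω.IsSymplectic) (m : M) :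
    IsSymplecticNear (Ω.bilinInChart m) (chartAt (EuclideanSpace ℝ (Fin d)) m m) := by
  have htgt : ∀ᶠ y in 𝓝 (chartAt (EuclideanSpace ℝ (Fin d)) m m),
      y ∈ (extChartAt (𝓡 d) m).target :=
    extChartAt_target_mem_nhds (I := 𝓡 d) m
  have hs : ∀ᶠ y in 𝓝 (chartAt (EuclideanSpace ℝ (Fin d)) m m),
      ContDiffAt ℝ ∞ (Ω.inChart m) y := by
    filter_upwards [htgt.eventually_nhds] with y hy
    exact (hΩ.smooth m).contDiffAt hy
  refine ⟨?_, ?_, ?_, ?_⟩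
  · filter_upwards [hs] with y hy
    exact contDiff_alternatingToBilinearCLM.contDiffAt.comp y hy
  · refine Filter.Eventually.of_forall fun y v w => ?_
    simp only [TwoForm.bilinInChart, alternatingToBilinearCLM_apply]
    exact ContinuousAlternatingMap.apply_pair_swap _ v w
  · filter_upwards [htgt, hs] with y h1 h2
    exact fderiv_alternatingToBilinearCLM_cyclic (h2.differentiableAt (by simp)) (hΩ.closed m y h1)
  · intro v hv
    have hm := mem_chart_source (EuclideanSpace ℝ (Fin d)) m
    obtain ⟨v, rfl⟩ := (chartDeriv m hm).surjective v
    have : v = 0 := hΩ.nondegenerate m v fun w => by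
      rw [← bilinInChart_chartDeriv Ω hm v w, hv]
      rfl
    rw [this, map_zero]

/-- The differential of a function on a manifold in terms of its local representative. -/
theorem mfderiv_comp_chart {F : Type*} [NormedAddCommGroup F] [NormedSpace ℝ F]
    {g : EuclideanSpace ℝ (Fin d) → F} {m x : M}
    (hx : x ∈ (chartAt (EuclideanSpace ℝ (Fin d)) m).source)
    (hg : DifferentiableAt ℝ g (chartAt (EuclideanSpace ℝ (Fin d)) m x))
    (v : TangentSpace (𝓡 d) x) :
    (mfderiv (𝓡 d) 𝓘(ℝ, F) (g ∘ chartAt (EuclideanSpace ℝ (Fin d)) m) x v : F) =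
      fderiv ℝ g (chartAt (EuclideanSpace ℝ (Fin d)) m x) (chartDeriv m hx v) := by
  have h : mfderiv (𝓡 d) 𝓘(ℝ, F) (g ∘ chartAt (EuclideanSpace ℝ (Fin d)) m) x = _ :=
    mfderiv_comp x hg.mdifferentiableAt (mdifferentiableAt_chart_of_mem hx)
  rw [h, mfderiv_eq_fderiv]
  rfl

/-- The local representative of a function on `M`. -/
theorem fderiv_comp_chart_symm {F : Type*} [NormedAddCommGroup F] [NormedSpace ℝ F]
    {f : M → F} {m x : M} (hx : x ∈ (chartAt (EuclideanSpace ℝ (Fin d)) m).source)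
    (hf : DifferentiableAt ℝ (f ∘ (chartAt (EuclideanSpace ℝ (Fin d)) m).symm)
      (chartAt (EuclideanSpace ℝ (Fin d)) m x)) (v : TangentSpace (𝓡 d) x) :
    fderiv ℝ (f ∘ (chartAt (EuclideanSpace ℝ (Fin d)) m).symm)
      (chartAt (EuclideanSpace ℝ (Fin d)) m x) (chartDeriv m hx v) =
      (mfderiv (𝓡 d) 𝓘(ℝ, F) f x v : F) := by
  set c := chartAt (EuclideanSpace ℝ (Fin d)) m
  rw [← mfderiv_comp_chart hx hf]
  have : (f ∘ c.symm) ∘ c =ᶠ[𝓝 x] f := by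
    filter_upwards [c.open_source.mem_nhds hx] with y hy
    simp [c.left_inv hy]
  exact DFunLike.congr_fun this.mfderiv_eq v

/-- Local representatives of smooth functions are smooth. -/
theorem eventually_contDiffAt_comp_chart_symm {F : Type*} [NormedAddCommGroup F] [NormedSpace ℝ F]
    {f : M → F} (m : M) (hf : ∀ᶠ x in 𝓝 m, ContMDiffAt (𝓡 d) 𝓘(ℝ, F) ∞ f x) :
    ∀ᶠ y in 𝓝 (chartAt (EuclideanSpace ℝ (Fin d)) m m),
      ContDiffAt ℝ ∞ (f ∘ (chartAt (EuclideanSpace ℝ (Fin d)) m).symm) y := by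
  set c := chartAt (EuclideanSpace ℝ (Fin d)) m
  have hm : m ∈ c.source := mem_chart_source _ m
  have hc : Filter.Tendsto c.symm (𝓝 (c m)) (𝓝 m) := by
    have := (c.continuousAt_symm (c.map_source hm)).tendsto
    rwa [c.left_inv hm] at this
  filter_upwards [c.open_target.mem_nhds (c.map_source hm), hc.eventually hf] with y hy hy'
  rw [← contMDiffAt_iff_contDiffAt]
  exact hy'.comp y ((contMDiffOn_chart_symm (I := 𝓡 d)).contMDiffAt (c.open_target.mem_nhds hy))

end Chart

/-! ### Hamiltonian fields and product neighbourhoods read in charts. -/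

section ChartHamiltonian

variable {d : ℕ} {M : Type*} [TopologicalSpace M] [ChartedSpace (EuclideanSpace ℝ (Fin d)) M]
  {k : ℕ} {N : Type*} [TopologicalSpace N] [ChartedSpace (EuclideanSpace ℝ (Fin k)) N]
  [IsManifold (𝓡 k) ∞ N]

/-- The differential of a map into `N` read in a chart of `N`. -/
theorem mfderiv_chart_comp {P : M → N} {m x : M} (hP : MDifferentiableAt (𝓡 d) (𝓡 k) P x)
    (hx : P x ∈ (chartAt (EuclideanSpace ℝ (Fin k)) (P m)).source) (v : TangentSpace (𝓡 d) x) :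
    (mfderiv (𝓡 d) (𝓡 k) (chartAt (EuclideanSpace ℝ (Fin k)) (P m) ∘ P) x v :
      EuclideanSpace ℝ (Fin k)) = chartDeriv (P m) hx (mfderiv (𝓡 d) (𝓡 k) P x v) :=
  DFunLike.congr_fun (mfderiv_comp x (mdifferentiableAt_chart_of_mem hx) hP) v

variable [IsManifold (𝓡 d) ∞ M]

/-- The chart carries Hamiltonian vector fields to Hamiltonian vector fields. -/
theorem hamiltonianField_chart {Ω : TwoForm (𝓡 d) M} {H : M → ℝ}
    {X : ∀ x : M, TangentSpace (𝓡 d) x} (hX : IsHamiltonianVectorField Ω H X) {m x : M}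
    (hx : x ∈ (chartAt (EuclideanSpace ℝ (Fin d)) m).source)
    (hB : (Ω.bilinInChart m (chartAt (EuclideanSpace ℝ (Fin d)) m x)).IsInvertible)
    (hH : DifferentiableAt ℝ (H ∘ (chartAt (EuclideanSpace ℝ (Fin d)) m).symm)
      (chartAt (EuclideanSpace ℝ (Fin d)) m x)) :
    hamiltonianField (Ω.bilinInChart m) (H ∘ (chartAt (EuclideanSpace ℝ (Fin d)) m).symm)
      (chartAt (EuclideanSpace ℝ (Fin d)) m x) = chartDeriv m hx (X x) := by
  have h1 : Ω.bilinInChart m (chartAt (EuclideanSpace ℝ (Fin d)) m x) (chartDeriv m hx (X x)) =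
      fderiv ℝ (H ∘ (chartAt (EuclideanSpace ℝ (Fin d)) m).symm)
        (chartAt (EuclideanSpace ℝ (Fin d)) m x) := by
    ext w
    obtain ⟨w, rfl⟩ := (chartDeriv m hx).surjective w
    exact ((bilinInChart_chartDeriv Ω hx (X x) w).trans (hX x w)).trans
      (fderiv_comp_chart_symm hx hH w).symm
  obtain ⟨e, he⟩ := hB
  rw [hamiltonianField, ← h1, ← he, ContinuousLinearMap.inverse_equiv]
  simp

/-- A map `(P, F)` whose representative in charts is a local diffeomorphism restricts to a
diffeomorphism onto a product neighbourhood. -/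
theorem exists_isProductNhd {l : ℕ} {P : M → N} (hP : ContMDiff (𝓡 d) (𝓡 k) ∞ P) (m : M)
    {F : EuclideanSpace ℝ (Fin d) → EuclideanSpace ℝ (Fin l)}
    (e : OpenPartialHomeomorph (EuclideanSpace ℝ (Fin d))
      (EuclideanSpace ℝ (Fin k) × EuclideanSpace ℝ (Fin l)))
    (hm : chartAt (EuclideanSpace ℝ (Fin d)) m m ∈ e.source)
    (he : ∀ y, e y = (chartAt (EuclideanSpace ℝ (Fin k)) (P m)
      (P ((chartAt (EuclideanSpace ℝ (Fin d)) m).symm y)), F y))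
    (hsource : ∀ y ∈ e.source, P ((chartAt (EuclideanSpace ℝ (Fin d)) m).symm y) ∈
      (chartAt (EuclideanSpace ℝ (Fin k)) (P m)).source ∧ ContDiffAt ℝ ∞ F y)
    (htarget : ∀ z ∈ e.target, ContDiffAt ℝ ∞ e.symm z) :
    ∃ (S : N × EuclideanSpace ℝ (Fin l) → M) (U : Set M) (V : Set N)
      (A : Set (EuclideanSpace ℝ (Fin l))), m ∈ U ∧
      (∀ x ∈ U, x ∈ (chartAt (EuclideanSpace ℝ (Fin d)) m).source ∧
        chartAt (EuclideanSpace ℝ (Fin d)) m x ∈ e.source) ∧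
      IsProductNhd (𝓡 d) (𝓡 k) (𝓡 l) P (F ∘ chartAt (EuclideanSpace ℝ (Fin d)) m) S U V A := by
  set c := chartAt (EuclideanSpace ℝ (Fin d)) m
  set c' := chartAt (EuclideanSpace ℝ (Fin k)) (P m)
  have hmc : m ∈ c.source := mem_chart_source _ m
  -- Undoing the chart of `N` on the first factor turns `e` into the map `(P, F ∘ c)` on an open
  -- part of `M`.
  set Ψ : OpenPartialHomeomorph M (N × EuclideanSpace ℝ (Fin l)) :=
    (c.trans e).trans (c'.prod (OpenPartialHomeomorph.refl _)).symm
  have hΨs : ∀ x, x ∈ Ψ.source ↔ (x ∈ c.source ∧ c x ∈ e.source) ∧ (e (c x)).1 ∈ c'.target := by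
    intro x
    simp [Ψ]
  have hΨ : ∀ x ∈ Ψ.source, Ψ x = (P x, F (c x)) := by
    intro x hx
    obtain ⟨⟨h1, h2⟩, -⟩ := (hΨs x).1 hx
    have h3 := (hsource _ h2).1
    rw [c.left_inv h1] at h3
    change (c'.symm (e (c x)).1, (e (c x)).2) = _
    rw [he, c.left_inv h1, c'.left_inv h3]
  have hmΨ : m ∈ Ψ.source := by
    refine (hΨs m).2 ⟨⟨hmc, hm⟩, ?_⟩
    rw [he, c.left_inv hmc]
    exact c'.map_source (mem_chart_source _ (P m))
  have hmt := Ψ.map_source hmΨ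
  -- The image of `Ψ` need not be a product; cutting down to the preimage of a box around `Ψ m`
  -- makes it one.
  obtain ⟨V, A, hV, hA, hmV, hmA, hVA⟩ := isOpen_prod_iff.1 Ψ.open_target _ _ hmt
  refine ⟨Ψ.symm, Ψ.source ∩ Ψ ⁻¹' (V ×ˢ A), V, A, ⟨hmΨ, hmV, hmA⟩,
    fun x hx => ((hΨs x).1 hx.1).1, ?_⟩
  refine ⟨Ψ.isOpen_inter_preimage (hV.prod hA), hV, hA, hP.contMDiffOn, ?_, ?_, ?_, ?_, ?_, ?_⟩
  · intro x hx
    obtain ⟨⟨h1, h2⟩, -⟩ := (hΨs x).1 hx.1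
    exact ((hsource _ h2).2.contMDiffAt.comp x
      ((contMDiffOn_chart (I := 𝓡 d)).contMDiffAt (c.open_source.mem_nhds h1))).contMDiffWithinAt
  · intro q hq
    have hqt := Ψ.map_target (hVA hq)
    obtain ⟨⟨h1, h2⟩, h3⟩ := (hΨs _).1 hqt
    have hq' : Ψ (Ψ.symm q) = q := Ψ.right_inv (hVA hq)
    have hq1 : q.1 ∈ c'.source := by
      rw [← hq']
      exact c'.map_target h3
    have hez : (c' q.1, q.2) = e (c (Ψ.symm q)) := by
      nth_rewrite 1 2 [← hq']
      exact Prod.ext (c'.right_inv h3) rfl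
    have hz : (c' q.1, q.2) ∈ e.target := by
      rw [hez]
      exact e.map_source h2
    have hy : e.symm (c' q.1, q.2) ∈ c.target := by
      rw [hez, e.left_inv h2]
      exact c.map_source h1
    have s1 : ContMDiffAt ((𝓡 k).prod (𝓡 l))
        𝓘(ℝ, EuclideanSpace ℝ (Fin k) × EuclideanSpace ℝ (Fin l)) ∞
        (fun q : N × EuclideanSpace ℝ (Fin l) => (c' q.1, q.2)) q :=
      (((contMDiffOn_chart (I := 𝓡 k)).contMDiffAt (c'.open_source.mem_nhds hq1)).comp q
        contMDiffAt_fst).prodMk_space contMDiffAt_snd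
    have s2 := (htarget _ hz).contMDiffAt.comp q s1
    have s3 : ContMDiffAt ((𝓡 k).prod (𝓡 l)) (𝓡 d) ∞
        (fun q : N × EuclideanSpace ℝ (Fin l) => c.symm (e.symm (c' q.1, q.2))) q :=
      ((contMDiffOn_chart_symm (I := 𝓡 d)).contMDiffAt (c.open_target.mem_nhds hy)).comp q s2
    exact s3.contMDiffWithinAt
  · intro x hx
    have := hx.2
    rwa [mem_preimage, hΨ x hx.1] at this
  · intro q hq
    refine ⟨Ψ.map_target (hVA hq), ?_⟩
    rw [mem_preimage, Ψ.right_inv (hVA hq)]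
    exact hq
  · intro x hx
    have := Ψ.left_inv hx.1
    rwa [hΨ x hx.1] at this
  · intro q hq
    have := Ψ.right_inv (hVA hq)
    rwa [hΨ _ (Ψ.map_target (hVA hq))] at this

end ChartHamiltonian

end

/-! ### The theorem, assembled around `m`. -/

theorem mainTheorem2 {d k : ℕ}
    {M : Type*} [TopologicalSpace M] [ChartedSpace (EuclideanSpace ℝ (Fin d)) M]
    [IsManifold (𝓡 d) ∞ M]
    {N : Type*} [TopologicalSpace N] [ChartedSpace (EuclideanSpace ℝ (Fin k)) N]
    [IsManifold (𝓡 k) ∞ N]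
    (Ω : TwoForm (𝓡 d) M) (hΩ : Ω.IsSymplectic)
    (H : M → ℝ) (hH : ContMDiff (𝓡 d) 𝓘(ℝ, ℝ) ∞ H)
    (X : ∀ x : M, TangentSpace (𝓡 d) x) (hX : IsHamiltonianVectorField Ω H X)
    (P : M → N) (hP : IsFibration (𝓡 d) (𝓡 k) P) (m : M)
    (hXm : X m ∉ kerDeriv (𝓡 d) (𝓡 k) P m)
    (hco : Ω.orth m (kerDeriv (𝓡 d) (𝓡 k) P m) ≤ kerDeriv (𝓡 d) (𝓡 k) P m) :
    ∃ l : ℕ, k + l = d ∧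
      ∃ (U : Set M) (F : M → EuclideanSpace ℝ (Fin l)) (S : N × EuclideanSpace ℝ (Fin l) → M),
        IsOpen U ∧ m ∈ U ∧
        IsFirstIntegralsSubmersionOn (𝓡 d) (𝓡 l) X F U ∧
        IsTransverseOn (𝓡 d) (𝓡 k) (𝓡 l) P F U ∧
        IsIsotropicMapOn (𝓡 d) (𝓡 l) Ω F U ∧
        InvOn S (fun x => (P x, F x)) U ((P '' U) ×ˢ (F '' U)) ∧
        IsCompleteSolutionAlong (𝓡 d) (𝓡 k) (𝓡 l) Ω H X P U (F '' U) S ∧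
        IsIsotropicSolutionOn (𝓡 k) Ω (P '' U) (F '' U) S := by
  set c := chartAt (EuclideanSpace ℝ (Fin d)) m
  set c' := chartAt (EuclideanSpace ℝ (Fin k)) (P m)
  have hmc : m ∈ c.source := mem_chart_source _ m
  have hmc' : P m ∈ c'.source := mem_chart_source _ (P m)
  have hPs : ContMDiff (𝓡 d) (𝓡 k) ∞ P := contMDiffOn_univ.1 hP.submersion.smooth
  have hPd : ∀ x, MDifferentiableAt (𝓡 d) (𝓡 k) P x := fun x => hPs.mdifferentiable (by simp) x
  have hPc : ∀ᶠ x in 𝓝 m, P x ∈ c'.source :=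
    hPs.continuous.continuousAt.eventually (c'.open_source.mem_nhds hmc')
  have hsymm : Filter.Tendsto c.symm (𝓝 (c m)) (𝓝 m) := by
    have := (c.continuousAt_symm (c.map_source hmc)).tendsto
    rwa [c.left_inv hmc] at this
  have hB := hΩ.isSymplecticNear m
  have hh : ∀ᶠ y in 𝓝 (c m), ContDiffAt ℝ ∞ (H ∘ c.symm) y :=
    eventually_contDiffAt_comp_chart_symm m (Filter.Eventually.of_forall fun x => hH x)
  have hp : ∀ᶠ y in 𝓝 (c m), ContDiffAt ℝ ∞ ((c' ∘ P) ∘ c.symm) y := by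
    refine eventually_contDiffAt_comp_chart_symm m ?_
    filter_upwards [hPc] with x hx
    exact ((contMDiffOn_chart (I := 𝓡 k)).contMDiffAt (c'.open_source.mem_nhds hx)).comp x (hPs x)
  set p : EuclideanSpace ℝ (Fin d) → EuclideanSpace ℝ (Fin k) := (c' ∘ P) ∘ c.symm
  have hdp : ∀ v, fderiv ℝ p (c m) (chartDeriv m hmc v) =
      chartDeriv (P m) hmc' (mfderiv (𝓡 d) (𝓡 k) P m v) := fun v =>
    (fderiv_comp_chart_symm hmc (hp.self_of_nhds.differentiableAt (by simp)) v).trans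
      (mfderiv_chart_comp (hPd m) hmc' v)
  set C : Submodule ℝ (EuclideanSpace ℝ (Fin d)) := LinearMap.ker (fderiv ℝ p (c m)).toLinearMap
  have hCmem : ∀ v : TangentSpace (𝓡 d) m,
      chartDeriv m hmc v ∈ C ↔ v ∈ kerDeriv (𝓡 d) (𝓡 k) P m := by
    intro v
    refine Iff.trans (Eq.congr_left (hdp v)) ?_
    exact map_eq_zero_iff _ (chartDeriv (P m) hmc').injective
  have hC : ∀ v, (∀ w ∈ C, Ω.bilinInChart m (c m) v w = 0) → v ∈ C := by
    intro v hv
    obtain ⟨v, rfl⟩ := (chartDeriv m hmc).surjective v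
    refine (hCmem v).2 (hco fun w hw => ?_)
    rw [← bilinInChart_chartDeriv Ω hmc v w]
    exact hv _ ((hCmem w).2 hw)
  have hXC : hamiltonianField (Ω.bilinInChart m) (H ∘ c.symm) (c m) ∉ C := by
    rw [hamiltonianField_chart hX hmc hB.isInvertible
      (hh.self_of_nhds.differentiableAt (by simp)), hCmem]
    exact hXm
  have hdim : k + Module.finrank ℝ C = d := by
    have h1 : Function.Surjective (fderiv ℝ p (c m)).toLinearMap := by
      intro w
      obtain ⟨w, rfl⟩ := (chartDeriv (P m) hmc').surjective w
      obtain ⟨v, rfl⟩ := hP.submersion.surjective_deriv m (mem_univ m) w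
      exact ⟨chartDeriv m hmc v, hdp v⟩
    have h2 := LinearMap.finrank_range_add_finrank_ker (fderiv ℝ p (c m)).toLinearMap
    rwa [LinearMap.range_eq_top.2 h1, finrank_top, finrank_euclideanSpace_fin,
      finrank_euclideanSpace_fin] at h2
  obtain ⟨F, hF, hFC⟩ := hB.exists_isotropic_submersion hh hC hXC rfl
  -- The extra property imposed on all of `e.source` records what is used pointwise: `P` lands in
  -- the chart of `N`, the form is invertible, `H` is smooth, and `F` has its first-integral and
  -- isotropy properties.
  obtain ⟨e, hme, he, hsource, htarget⟩ := exists_openPartialHomeomorph_prodMk hp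
    (hF.mono fun y hy => hy.1) hFC.disjoint (by simpa using hdim.symm)
    ((hsymm.eventually hPc).and ((hB.eventually_isInvertible.and hh).and hF))
  obtain ⟨S, U, V, A, hmU, hU, hprod⟩ := exists_isProductNhd hPs m e hme he
    (fun y hy => ⟨(hsource y hy).1.1, (hsource y hy).2.2.1⟩) htarget
  have hdF : ∀ x (hx : x ∈ U) (v : TangentSpace (𝓡 d) x),
      mfderiv (𝓡 d) 𝓘(ℝ, EuclideanSpace ℝ (Fin (Module.finrank ℝ C))) (F ∘ c) x v =
        fderiv ℝ F (c x) (chartDeriv m (hU x hx).1 v) := fun x hx v =>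
    mfderiv_comp_chart (hU x hx).1 ((hsource _ (hU x hx).2).2.2.1.differentiableAt (by simp)) v
  have hXF : ∀ x ∈ U, X x ∈ kerDeriv (𝓡 d) (𝓡 (Module.finrank ℝ C)) (F ∘ c) x := by
    intro x hx
    obtain ⟨-, ⟨h1, h2⟩, h3⟩ := (hsource _ (hU x hx).2).1
    refine (hdF x hx (X x)).trans ?_
    rw [← hamiltonianField_chart hX (hU x hx).1 h1 (h2.differentiableAt (by simp))]
    exact h3.2.1
  have hiso : IsIsotropicMapOn (𝓡 d) (𝓡 (Module.finrank ℝ C)) Ω (F ∘ c) U := by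
    intro x hx v hv w hw
    -- Isotropy in `h3` is conditional on surjectivity of the differential of `F`, which `h4`
    -- supplies from the local diffeomorphism.
    obtain ⟨⟨-, -, h3⟩, -, -, h4⟩ := hsource _ (hU x hx).2
    rw [← bilinInChart_chartDeriv Ω (hU x hx).1 v w]
    exact h3.2.2 h4 _ _ ((hdF x hx v).symm.trans hv) ((hdF x hx w).symm.trans hw)
  have hV : V.Nonempty := ⟨_, (hprod.mapsTo hmU).1⟩
  have hA : A.Nonempty := ⟨_, (hprod.mapsTo hmU).2⟩
  refine ⟨Module.finrank ℝ C, hdim, U, F ∘ c, S, hprod.isOpen_U, hmU,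
    ⟨hprod.isSmoothSubmersionOn, hXF⟩, hprod.isTransverseOn, hiso, ?_⟩
  rw [hprod.image_P hA, hprod.image_F hV]
  exact ⟨hprod.invOn, hprod.isCompleteSolutionAlong hA hX hXF, hprod.isIsotropicSolutionOn hiso⟩
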